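/- **Conventions.** Work in the two-sorted language of second-order arithmetic (number variables; set variables; $0,1,+,\cdot,<,\in$). The theory $\mathsf{RCA}_0$ consists of the axioms of a discretely ordered commutative semiring with identity, induction for $\Sigma^0_1$ formulas, and $\Delta^0_1$ comprehension; $\mathsf{ACA}_0$ consists of the same semiring axioms, the induction axiom $\forall X[(0\in X\wedge\forall n(n\in X\to n+1\in X))\to\forall n\,(n\in X)]$, and comprehension for all arithmetical formulas. Parameters are allowed in all schemes. The following definitions are made in $\mathsf{RCA}_0$. Pairs and finite sets of numbers are coded by numbers in the usual way. A quasi-order $(Q,\le_Q)$ is a set $Q\subseteq\mathbb N$ with a reflexive and transitive relation $\le_Q\,\subseteq Q\times Q$. It is a *wqo* if for every function $f:\mathbb N\to Q$ there are $m<n$ with $f(m)\le_Q f(n)$. Let $\mathcal P_{\mathrm f}(Q)$ be the set of (codes of) finite subsets of $Q$, and let $\mathcal P_{\mathrm f}^\flat(Q)$ be $\mathcal P_{\mathrm f}(Q)$ with the quasi-order $$\mathbf a\le^\flat_Q\mathbf b \iff (\forall a\in\mathbf a)(\exists b\in\mathbf b)(a\le_Q b).$$ For a quasi-order $R$, let $\mathrm{upper}(R)$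 be the countable second-countable space with set of points $R$ and basic open sets $$U_{\mathbf i}=\{x\in R:\neg(\exists p\in\mathbf i)(x\le_R p)\},\qquad \mathbf i\in\mathcal P_{\mathrm f}(R).$$ A function $g:\mathbb N\times\mathbb N\to\mathcal P_{\mathrm f}(\mathcal P_{\mathrm f}(R))$ codes the sequence of effectively closed sets $F_n=\{x\in R:\forall m\,(\forall \mathbf i\in g(n,m))\,(x\notin U_{\mathbf i})\}$. The space $\mathrm{upper}(R)$ is *Noetherian* if for every such sequence with $F_{n+1}\subseteq F_n$ for all $n$, there is an $N$ such that $F_n=F_N$ for all $n>N$. **Theorem.** Over $\mathsf{RCA}_0$, the statement "if $Q$ is a wqo, then $\mathrm{upper}(\mathcal P_{\mathrm f}^\flat(Q))$ is Noetherian" (for all quasi-orders $Q$) implies $\mathsf{ACA}_0$. That is, every structure for the language of second-order arithmetic (with arbitrary, possibly nonstandard, first-order part and with set variables ranging over an arbitrary nonempty family of subsets of it) that satisfies $\mathsf{RCA}_0$ and this statement also satisfies $\mathsf{ACA}_0$. -/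

import Mathlib

namespace SecondOrderArithmetic

universe u

/-! ### The language of second-order arithmetic and its structures -/

/-- Numerical terms. Number variables are de Bruijn indices. -/
inductive Term where
  | var (i : ℕ) : Term
  | zero : Term
  | one : Term
  | add (t s : Term) : Term
  | mul (t s : Term) : Term

/-- Raise all variables of a term by one, so that it does not mention the variable `0`. -/
def Term.shift : Term → Term
  | var i => var (i + 1)
  | zero => zero
  | one => one
  | add t s => add t.shift s.shift
  | mul t s => mul t.shift s.shift

/-- Formulas of the two-sorted language of second-order arithmetic. Number variables and set
variables are two separate families of de Bruijn indices; `all` binds the number variable `0`,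
`allSet` binds the set variable `0`. -/
inductive Formula where
  | eq (t s : Term) : Formula
  | lt (t s : Term) : Formula
  | mem (t : Term) (X : ℕ) : Formula
  | neg (φ : Formula) : Formula
  | imp (φ ψ : Formula) : Formula
  | all (φ : Formula) : Formula
  | allSet (φ : Formula) : Formula

/-- The number quantifier `∃`. -/
def Formula.ex (φ : Formula) : Formula := .neg (.all (.neg φ))

/-- `∀ x < t, φ`, where `x` is bound and does not occur in `t`. -/
def Formula.ballLT (t : Term) (φ : Formula) : Formula :=
  .all (.imp (.lt (.var 0) t.shift) φ)

/-- `Σ⁰₀` formulas: all quantifiers are bounded number quantifiers. Bounded existential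
quantifiers are obtained from bounded universal ones by negation. -/
inductive Formula.IsSigma00 : Formula → Prop
  | eq (t s : Term) : IsSigma00 (.eq t s)
  | lt (t s : Term) : IsSigma00 (.lt t s)
  | mem (t : Term) (X : ℕ) : IsSigma00 (.mem t X)
  | neg {φ : Formula} : IsSigma00 φ → IsSigma00 (.neg φ)
  | imp {φ ψ : Formula} : IsSigma00 φ → IsSigma00 ψ → IsSigma00 (.imp φ ψ)
  | ballLT (t : Term) {φ : Formula} : IsSigma00 φ → IsSigma00 (Formula.ballLT t φ)

/-- `Σ⁰₁` formulas: `∃ x, θ` with `θ` a `Σ⁰₀` formula. -/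
def Formula.IsSigma01 (φ : Formula) : Prop := ∃ θ : Formula, θ.IsSigma00 ∧ φ = .ex θ

/-- `Π⁰₁` formulas: `∀ x, θ` with `θ` a `Σ⁰₀` formula. -/
def Formula.IsPi01 (φ : Formula) : Prop := ∃ θ : Formula, θ.IsSigma00 ∧ φ = .all θ

/-- Arithmetical formulas: no set quantifiers (free set variables are allowed). -/
def Formula.IsArithmetical : Formula → Prop
  | .eq _ _ => True
  | .lt _ _ => True
  | .mem _ _ => True
  | .neg φ => φ.IsArithmetical
  | .imp φ ψ => φ.IsArithmetical ∧ ψ.IsArithmetical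
  | .all φ => φ.IsArithmetical
  | .allSet _ => False

/-- A structure for the language of second-order arithmetic: number variables range over `M`,
which may be nonstandard, and set variables range over the nonempty family `sets` of subsets
of `M`, which need not contain all subsets. -/
class L2Structure (M : Type u) extends Zero M, One M, Add M, Mul M, LT M where
  sets : Set (Set M)
  sets_nonempty : sets.Nonempty

/-- Extend an assignment by a value for the variable `0`. -/
def push {α : Type u} (a : α) (e : ℕ → α) : ℕ → α
  | 0 => a
  | k + 1 => e k

section Semantics

variable {M : Type u} [L2Structure M]

/-- The value of a term. -/
def Term.val (e : ℕ → M) : Term → M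
  | var i => e i
  | zero => 0
  | one => 1
  | add t s => t.val e + s.val e
  | mul t s => t.val e * s.val e

/-- Satisfaction of a formula under an assignment of numbers and sets to the variables. -/
def Formula.Holds : Formula → (ℕ → M) → (ℕ → Set M) → Prop
  | .eq t s, e, _ => t.val e = s.val e
  | .lt t s, e, _ => t.val e < s.val e
  | .mem t X, e, E => t.val e ∈ E X
  | .neg φ, e, E => ¬ φ.Holds e E
  | .imp φ ψ, e, E => φ.Holds e E → ψ.Holds e E
  | .all φ, e, E => ∀ x : M, φ.Holds (push x e) E
  | .allSet φ, e, E => ∀ X ∈ L2Structure.sets (M := M), φ.Holds e (push X E)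

end Semantics

/-! ### The theories `RCA₀` and `ACA₀` -/

/-- The numbers form a discretely ordered commutative semiring with identity. -/
structure DiscretelyOrderedSemiring (M : Type u) [L2Structure M] : Prop where
  add_assoc : ∀ x y z : M, (x + y) + z = x + (y + z)
  add_comm : ∀ x y : M, x + y = y + x
  add_zero : ∀ x : M, x + 0 = x
  mul_assoc : ∀ x y z : M, (x * y) * z = x * (y * z)
  mul_comm : ∀ x y : M, x * y = y * x
  mul_one : ∀ x : M, x * 1 = x
  mul_zero : ∀ x : M, x * 0 = 0
  mul_add : ∀ x y z : M, x * (y + z) = x * y + x * z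
  lt_irrefl : ∀ x : M, ¬ x < x
  lt_trans : ∀ x y z : M, x < y → y < z → x < z
  lt_trichotomy : ∀ x y : M, x < y ∨ x = y ∨ y < x
  add_lt_add : ∀ x y z : M, x < y → x + z < y + z
  mul_lt_mul : ∀ x y z : M, 0 < z → x < y → x * z < y * z
  exists_add_of_lt : ∀ x y : M, x < y → ∃ z : M, x + z = y
  zero_lt_one : (0 : M) < 1
  eq_or_lt : ∀ x : M, x = 0 ∨ 0 < x
  discrete : ∀ x : M, 0 < x → x = 1 ∨ 1 < x

/-- `M` is a model of `RCA₀`. The parameters of the schemes are the values of `e` and `E`; the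
variable that an instance singles out is the number variable `0`. -/
structure IsModelRCA0 (M : Type u) [L2Structure M] : Prop where
  semiring : DiscretelyOrderedSemiring M
  sigma01_induction : ∀ φ : Formula, φ.IsSigma01 →
    ∀ (e : ℕ → M) (E : ℕ → Set M), (∀ k, E k ∈ L2Structure.sets) →
      φ.Holds (push 0 e) E →
      (∀ n : M, φ.Holds (push n e) E → φ.Holds (push (n + 1) e) E) →
      ∀ n : M, φ.Holds (push n e) E
  delta01_comprehension : ∀ φ ψ : Formula, φ.IsSigma01 → ψ.IsPi01 →
    ∀ (e : ℕ → M) (E : ℕ → Set M), (∀ k, E k ∈ L2Structure.sets) →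
      (∀ n : M, φ.Holds (push n e) E ↔ ψ.Holds (push n e) E) →
      ∃ X ∈ L2Structure.sets (M := M), ∀ n : M, n ∈ X ↔ φ.Holds (push n e) E

/-- `M` is a model of `ACA₀`. -/
structure IsModelACA0 (M : Type u) [L2Structure M] : Prop where
  semiring : DiscretelyOrderedSemiring M
  induction : ∀ X ∈ L2Structure.sets (M := M),
    (0 : M) ∈ X → (∀ n : M, n ∈ X → n + 1 ∈ X) → ∀ n : M, n ∈ X
  arithmetical_comprehension : ∀ φ : Formula, φ.IsArithmetical →
    ∀ (e : ℕ → M) (E : ℕ → Set M), (∀ k, E k ∈ L2Structure.sets) →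
      ∃ X ∈ L2Structure.sets (M := M), ∀ n : M, n ∈ X ↔ φ.Holds (push n e) E

/-! ### Coding inside a structure -/

section Coding

variable {M : Type u} [L2Structure M]

/-- The code `(i + j)² + i` of an ordered pair. -/
def pair (i j : M) : M := (i + j) * (i + j) + i

/-- `c` is of the form `(k, (m, n))`; such a triple represents the finite set of all `i < k` for
which `m (i + 1) + 1` divides `n`. -/
def IsTriple (c : M) : Prop := ∃ k m n : M, c = pair k (pair m n)

/-- `i` belongs to the finite set represented by `c`. -/
def FinMem (i c : M) : Prop :=
  ∃ k m n : M, c = pair k (pair m n) ∧ i < k ∧ ∃ q : M, n = (m * (i + 1) + 1) * q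

/-- `c` is the code of a finite set, that is, the least number representing it. -/
def IsFinCode (c : M) : Prop :=
  IsTriple c ∧ ∀ d : M, d < c → IsTriple d → ¬ ∀ i : M, FinMem i d ↔ FinMem i c

/-- `P_f(A)`: the (codes of) finite subsets of `A`. -/
def finSubsets (A : Set M) : Set M := {c | IsFinCode c ∧ ∀ i : M, FinMem i c → i ∈ A}

/-- The product `A × B`, as a set of codes of pairs. -/
def prodSet (A B : Set M) : Set M := {p | ∃ a ∈ A, ∃ b ∈ B, p = pair a b}

/-- `F` is a member of the second-order part that is (the graph of) a function `A → B`. -/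
def IsFunction (F A B : Set M) : Prop :=
  F ∈ L2Structure.sets ∧ F ⊆ prodSet A B ∧ ∀ a ∈ A, ∃! b : M, pair a b ∈ F

end Coding

/-! ### Quasi-orders -/

/-- A set of numbers together with a binary relation given as a set of codes of pairs. -/
structure CodedRel (M : Type u) where
  carrier : Set M
  le : Set M

section Orders

variable {M : Type u} [L2Structure M]

/-- `a ≤_Q b`. -/
def CodedRel.Le (Q : CodedRel M) (a b : M) : Prop := pair a b ∈ Q.le

/-- `Q` is a quasi-order of the structure: its domain and its relation belong to the
second-order part, and the relation is reflexive and transitive on the domain. -/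
structure CodedRel.IsQuasiOrder (Q : CodedRel M) : Prop where
  carrier_mem : Q.carrier ∈ L2Structure.sets
  le_mem : Q.le ∈ L2Structure.sets
  le_subset : Q.le ⊆ prodSet Q.carrier Q.carrier
  refl : ∀ q ∈ Q.carrier, Q.Le q q
  trans : ∀ p ∈ Q.carrier, ∀ q ∈ Q.carrier, ∀ r ∈ Q.carrier, Q.Le p q → Q.Le q r → Q.Le p r

/-- `Q` is a well-quasi-order: for every function `f : ℕ → Q` of the structure there are `m < n`
with `f m ≤_Q f n`. -/
def CodedRel.IsWqo (Q : CodedRel M) : Prop :=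
  Q.IsQuasiOrder ∧ ∀ F : Set M, IsFunction F Set.univ Q.carrier →
    ∃ m n a b : M, m < n ∧ pair m a ∈ F ∧ pair n b ∈ F ∧ Q.Le a b

/-- `P_f^♭(Q)`: the finite subsets of `Q`, with `a ≤^♭ b` if and only if every element of `a` is
below some element of `b`. -/
def CodedRel.finFlat (Q : CodedRel M) : CodedRel M where
  carrier := finSubsets Q.carrier
  le := {p | ∃ a ∈ finSubsets Q.carrier, ∃ b ∈ finSubsets Q.carrier, p = pair a b ∧
    ∀ i : M, FinMem i a → ∃ j : M, FinMem j b ∧ Q.Le i j}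

end Orders

/-! ### Countable second-countable spaces -/

/-- A set `points` of numbers with a family `(U_i)` of subsets indexed by `index`, where
`basic x i` says that `x ∈ U_i`. A base also has a function `k` with
`x ∈ U_{k(x,i,j)} ⊆ U_i ∩ U_j` for `x ∈ U_i ∩ U_j`; effectively open and closed sets, and being
Noetherian, do not refer to it. -/
structure CodedSpace (M : Type u) where
  points : Set M
  index : Set M
  basic : M → M → Prop

section Spaces

variable {M : Type u} [L2Structure M]

/-- The `n`-th term of the sequence of effectively closed sets coded by a function
`G : ℕ × ℕ → P_f(I)`: the points that lie in no `U_i` with `i ∈ G(n, m)`, for any `m`. -/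
def CodedSpace.closedTerm (X : CodedSpace M) (G : Set M) (n : M) : Set M :=
  {x ∈ X.points | ∀ m c i : M, pair (pair n m) c ∈ G → FinMem i c → ¬ X.basic x i}

/-- Every descending sequence of effectively closed sets (coded in the structure) stabilizes. -/
def CodedSpace.IsNoetherian (X : CodedSpace M) : Prop :=
  ∀ G : Set M, IsFunction G (prodSet Set.univ Set.univ) (finSubsets X.index) →
    (∀ n : M, X.closedTerm G (n + 1) ⊆ X.closedTerm G n) →
    ∃ N : M, ∀ n : M, N < n → X.closedTerm G n = X.closedTerm G N

/-- The upper topology of `Q`: its basic open sets are the sets `Q \ (i↓)` for `i ∈ P_f(Q)`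
(so that the function `k` of the base is `k(q, i, j) = i ∪ j`). -/
def CodedRel.upper (Q : CodedRel M) : CodedSpace M where
  points := Q.carrier
  index := finSubsets Q.carrier
  basic x i := x ∈ Q.carrier ∧ ¬ ∃ p : M, FinMem p i ∧ Q.Le x p

end Spaces

/-- `M` satisfies the statement "if `Q` is a well-quasi-order, then the upper topology of
`P_f^♭(Q)` is Noetherian". -/
def FlatUpperNoetherian (M : Type u) [L2Structure M] : Prop :=
  ∀ Q : CodedRel M, Q.IsWqo → Q.finFlat.upper.IsNoetherian

end SecondOrderArithmetic

/-!
`Σ⁰₁` comprehension holds if the range of every injection `g` that is definable by a bounded formula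
is a set of the model. Order the stages of the enumeration `g` in such a way that `t` precedes a
later stage `s` if and only if some stage up to `s` has a value below `g t`. The false stages, those
with a later smaller value, then form an initial segment of type `ω` (seen from outside), and the
true ones follow it in reverse order. Take the product with the order of the values of `g`, to which
two elements are added at the top. In a bad sequence in this product the stages are unbounded and
eventually true, so such a sequence computes the range of `g`; if the range is not a set of the
model, the product is hence a wqo.

On the other hand, to each `n` assign the finite set of all pairs of a stage `s ≤ n` and the value
at the stage `r` in `(s, n]` where the value is least, with a top element for `s = n`. Each of these
pairs generates an up-closed set, whose complement is generated by two elements, since doubling `g`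
provides immediate predecessors in both orders. The finite sets that are below one of these
complements form a closed set `C n` for the upper topology. The finite set for `n` belongs to `C m`
for all `m < n` but not to `C n`, so that the partial intersections of these sets never stabilize.
-/

namespace SecondOrderArithmetic

universe u

/-! ### Discretely ordered semirings -/

section Arithmetic

variable {M : Type u} [L2Structure M] [hM : Fact (DiscretelyOrderedSemiring M)]

instance : CommSemiring M where
  add_assoc := hM.out.add_assoc
  add_comm := hM.out.add_comm
  add_zero := hM.out.add_zero
  zero_add x := (hM.out.add_comm _ _).trans (hM.out.add_zero x)
  mul_assoc := hM.out.mul_assoc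
  mul_comm := hM.out.mul_comm
  mul_one := hM.out.mul_one
  one_mul x := (hM.out.mul_comm _ _).trans (hM.out.mul_one x)
  mul_zero := hM.out.mul_zero
  zero_mul x := (hM.out.mul_comm _ _).trans (hM.out.mul_zero x)
  left_distrib := hM.out.mul_add
  right_distrib x y z := by
    rw [hM.out.mul_comm, hM.out.mul_add, hM.out.mul_comm z x, hM.out.mul_comm z y]
  nsmul := nsmulRec
  npow := npowRec

open Classical in
noncomputable instance : LinearOrder M :=
  have : IsTrans M (· < ·) := ⟨hM.out.lt_trans⟩
  have : Std.Irrefl (α := M) (· < ·) := ⟨hM.out.lt_irrefl⟩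
  have : Std.Trichotomous (α := M) (· < ·) := ⟨fun x y h h' =>
    ((hM.out.lt_trichotomy x y).resolve_left h).resolve_right h'⟩
  have : IsStrictTotalOrder M (· < ·) := {}
  linearOrderOfSTO (· < ·)

instance : IsStrictOrderedRing M :=
  have add_lt_add (a b c : M) (h : a < b) : c + a < c + b := by
    simpa only [add_comm c] using hM.out.add_lt_add _ _ c h
  have zero_lt_one : (0 : M) < 1 := hM.out.zero_lt_one
  { add_le_add_left a b h c := h.eq_or_lt.elim (fun h => (congrArg (· + c) h).le)
      fun h => (hM.out.add_lt_add _ _ c h).le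
    le_of_add_le_add_left a b c h := not_lt.1 fun hb => (add_lt_add _ _ a hb).not_ge h
    zero_le_one := zero_lt_one.le
    exists_pair_ne := ⟨0, 1, zero_lt_one.ne⟩
    mul_lt_mul_of_pos_left c hc a b h := by
      simpa only [mul_comm c] using hM.out.mul_lt_mul _ _ c hc h
    mul_lt_mul_of_pos_right c hc a b h := hM.out.mul_lt_mul _ _ c hc h }

instance : CanonicallyOrderedAdd M :=
  have nonneg (b : M) : 0 ≤ b := (hM.out.eq_or_lt b).elim ge_of_eq le_of_lt
  { exists_add_of_le {a b} h := by
      obtain rfl | h := h.eq_or_lt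
      · exact ⟨0, (add_zero _).symm⟩
      · exact (hM.out.exists_add_of_lt _ _ h).imp fun _ => Eq.symm
    le_add_self _ b := le_add_of_nonneg_left (nonneg b)
    le_self_add _ b := le_add_of_nonneg_right (nonneg b) }

noncomputable instance : SuccOrder M :=
  .ofSuccLeIff (· + 1) fun {a b} => by
    refine ⟨(lt_add_one a).trans_le, fun h => ?_⟩
    obtain ⟨c, rfl⟩ := exists_add_of_le h.le
    exact add_le_add_right ((hM.out.discrete c (by simpa using h)).elim ge_of_eq le_of_lt) a

noncomputable instance : SuccAddOrder M := ⟨fun _ => rfl⟩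

theorem le_mul_self (x : M) : x ≤ x * x := by
  obtain rfl | h := eq_zero_or_pos x
  · exact zero_le
  · exact le_mul_of_one_le_left' (Order.one_le_iff_pos.2 h)

theorem left_le_pair (i j : M) : i ≤ pair i j := le_add_self

theorem right_le_pair (i j : M) : j ≤ pair i j :=
  (le_add_self.trans (le_mul_self (i + j))).trans le_self_add

theorem pair_le_pair {i j i' j' : M} (hi : i ≤ i') (hj : j ≤ j') : pair i j ≤ pair i' j' := by
  unfold pair
  gcongr

theorem pair_lt_pair_of_add_lt {i j i' j' : M} (h : i + j < i' + j') : pair i j < pair i' j' :=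
  calc pair i j < pair i j + (i + j + j + 1) := by simp
    _ = (i + j + 1) * (i + j + 1) := by unfold pair; ring
    _ ≤ (i' + j') * (i' + j') := by
      have := Order.add_one_le_iff.2 h
      gcongr
    _ ≤ pair i' j' := le_self_add

theorem pair_inj {i j i' j' : M} : pair i j = pair i' j' ↔ i = i' ∧ j = j' := by
  refine ⟨fun h => ?_, fun ⟨hi, hj⟩ => hi ▸ hj ▸ rfl⟩
  have hs : i + j = i' + j' := by
    by_contra hs
    rcases lt_or_gt_of_ne hs with hs | hs
    · exact (pair_lt_pair_of_add_lt hs).ne h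
    · exact (pair_lt_pair_of_add_lt hs).ne' h
  have hi : i = i' := by simpa only [pair, hs, add_right_inj] using h
  exact ⟨hi, by simpa only [hi, add_right_inj] using hs⟩

end Arithmetic

/-! ### Renaming of variables -/

/-- The extension of a renaming of variables to the scope of a quantifier. -/
def liftRename (ρ : ℕ → ℕ) : ℕ → ℕ := push 0 fun k => ρ k + 1

/-- Renaming of the number variables of a term. -/
def Term.rename (ρ : ℕ → ℕ) : Term → Term
  | var i => var (ρ i)
  | zero => zero
  | one => one
  | add t s => add (t.rename ρ) (s.rename ρ)
  | mul t s => mul (t.rename ρ) (s.rename ρ)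

/-- Renaming of the free number variables along `ρ` and of the free set variables along `σ`. -/
def Formula.rename : Formula → (ℕ → ℕ) → (ℕ → ℕ) → Formula
  | eq t s, ρ, _ => eq (t.rename ρ) (s.rename ρ)
  | lt t s, ρ, _ => lt (t.rename ρ) (s.rename ρ)
  | mem t X, ρ, σ => mem (t.rename ρ) (σ X)
  | neg φ, ρ, σ => neg (φ.rename ρ σ)
  | imp φ ψ, ρ, σ => imp (φ.rename ρ σ) (ψ.rename ρ σ)
  | all φ, ρ, σ => all (φ.rename (liftRename ρ) σ)
  | allSet φ, ρ, σ => allSet (φ.rename ρ (liftRename σ))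

theorem push_comp_liftRename {α : Type*} (x : α) (e : ℕ → α) (ρ : ℕ → ℕ) :
    push x e ∘ liftRename ρ = push x (e ∘ ρ) := by
  funext k
  cases k <;> rfl

theorem Term.rename_shift (t : Term) (ρ : ℕ → ℕ) :
    t.shift.rename (liftRename ρ) = (t.rename ρ).shift := by
  induction t with
  | var | zero | one => rfl
  | add _ _ iht ihs => exact congrArg₂ add iht ihs
  | mul _ _ iht ihs => exact congrArg₂ mul iht ihs

theorem Formula.IsSigma00.rename {φ : Formula} (h : φ.IsSigma00) (ρ σ : ℕ → ℕ) :
    (φ.rename ρ σ).IsSigma00 := by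
  induction h generalizing ρ with
  | eq => exact .eq _ _
  | lt => exact .lt _ _
  | mem => exact .mem _ _
  | neg _ ih => exact .neg (ih ρ)
  | imp _ _ ih₁ ih₂ => exact .imp (ih₁ ρ) (ih₂ ρ)
  | ballLT t _ ih =>
    have := IsSigma00.ballLT (t.rename ρ) (ih (liftRename ρ))
    rwa [Formula.ballLT, ← t.rename_shift] at this

section Definability

variable {M : Type u} [L2Structure M]

theorem Term.val_rename (t : Term) (ρ : ℕ → ℕ) (e : ℕ → M) :
    (t.rename ρ).val e = t.val (e ∘ ρ) := by
  induction t with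
  | var | zero | one => rfl
  | add _ _ iht ihs => exact congrArg₂ (· + ·) iht ihs
  | mul _ _ iht ihs => exact congrArg₂ (· * ·) iht ihs

theorem Term.val_shift (t : Term) (x : M) (e : ℕ → M) : t.shift.val (push x e) = t.val e := by
  induction t with
  | var | zero | one => rfl
  | add _ _ iht ihs => exact congrArg₂ (· + ·) iht ihs
  | mul _ _ iht ihs => exact congrArg₂ (· * ·) iht ihs

theorem Formula.holds_rename (φ : Formula) (ρ σ : ℕ → ℕ) (e : ℕ → M) (E : ℕ → Set M) :
    (φ.rename ρ σ).Holds e E ↔ φ.Holds (e ∘ ρ) (E ∘ σ) := by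
  induction φ generalizing ρ σ e E with
  | eq | lt | mem => simp only [rename, Holds, Term.val_rename, Function.comp_apply]
  | neg φ ih => simp only [rename, Holds, ih]
  | imp φ ψ ih₁ ih₂ => simp only [rename, Holds, ih₁, ih₂]
  | all φ ih => simp only [rename, Holds, ih, push_comp_liftRename]
  | allSet φ ih => simp only [rename, Holds, ih, push_comp_liftRename]

/-! ### Predicates definable with parameters -/

/-- The functions `(ℕ → M) → M` given by terms with parameters from `M`; a class, so that they are
recognized by instance search. -/
class inductive TermDef : ((ℕ → M) → M) → Prop
  | const (c : M) : TermDef fun _ => c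
  | var (i : ℕ) : TermDef fun e => e i
  | of_add {t s} : TermDef t → TermDef s → TermDef fun e => t e + s e
  | of_mul {t s} : TermDef t → TermDef s → TermDef fun e => t e * s e

/-- The predicates on `ℕ → M` given by `Σ⁰₀` formulas with number and set parameters from the
structure; a class, so that they are recognized by instance search. -/
class inductive Sigma0 : ((ℕ → M) → Prop) → Prop
  | of_eq {t s} : TermDef t → TermDef s → Sigma0 fun e => t e = s e
  | of_lt {t s} : TermDef t → TermDef s → Sigma0 fun e => t e < s e
  | of_mem {t X} : TermDef t → X ∈ L2Structure.sets (M := M) → Sigma0 fun e => t e ∈ X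
  | of_not {P} : Sigma0 P → Sigma0 fun e => ¬ P e
  | of_imp {P Q} : Sigma0 P → Sigma0 Q → Sigma0 fun e => P e → Q e
  | of_ballLT {t} {P : M → (ℕ → M) → Prop} : TermDef t →
      (Sigma0 fun e => P (e 0) fun k => e (k + 1)) → Sigma0 fun e => ∀ x, x < t e → P x e

attribute [instance] TermDef.const TermDef.var

theorem TermDef.subst {t : (ℕ → M) → M} (ht : TermDef t) (T : ℕ → (ℕ → M) → M)
    (hT : ∀ k, TermDef (T k)) : TermDef fun e => t fun k => T k e := by
  induction ht with
  | const c => exact .const c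
  | var i => exact hT i
  | of_add _ _ iht ihs => exact iht.of_add ihs
  | of_mul _ _ iht ihs => exact iht.of_mul ihs

theorem TermDef.shift {t : (ℕ → M) → M} (ht : TermDef t) : TermDef fun e => t fun k => e (k + 1) :=
  ht.subst _ fun k => .var (k + 1)

theorem Sigma0.subst {P : (ℕ → M) → Prop} (hP : Sigma0 P) (T : ℕ → (ℕ → M) → M)
    (hT : ∀ k, TermDef (T k)) : Sigma0 fun e => P fun k => T k e := by
  induction hP generalizing T with
  | of_eq ht hs => exact .of_eq (ht.subst T hT) (hs.subst T hT)
  | of_lt ht hs => exact .of_lt (ht.subst T hT) (hs.subst T hT)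
  | of_mem ht hX => exact .of_mem (ht.subst T hT) hX
  | of_not _ ih => exact (ih T hT).of_not
  | of_imp _ _ ih₁ ih₂ => exact (ih₁ T hT).of_imp (ih₂ T hT)
  | @of_ballLT t P ht _ ih =>
    exact .of_ballLT (P := fun x e => P x fun k => T k e) (ht.subst T hT) <|
      ih (push (fun e => e 0) fun k e => T k fun j => e (j + 1)) fun
        | 0 => .var 0
        | k + 1 => (hT k).shift

section Closure

variable {t s : (ℕ → M) → M} {P Q : (ℕ → M) → Prop}

instance TermDef.add [ht : TermDef t] [hs : TermDef s] : TermDef fun e => t e + s e :=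
  ht.of_add hs

instance TermDef.mul [ht : TermDef t] [hs : TermDef s] : TermDef fun e => t e * s e :=
  ht.of_mul hs

instance TermDef.pair [TermDef t] [TermDef s] : TermDef fun e => pair (t e) (s e) := by
  unfold SecondOrderArithmetic.pair
  infer_instance

theorem Sigma0.congr (hP : Sigma0 P) (h : ∀ e, Q e ↔ P e) : Sigma0 Q :=
  (funext fun e => propext (h e) : Q = P) ▸ hP

theorem Sigma0.comp {P : M → Prop} (hP : Sigma0 fun e => P (e 0)) (t : (ℕ → M) → M)
    [ht : TermDef t] : Sigma0 fun e => P (t e) :=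
  hP.subst (fun _ => t) fun _ => ht

theorem Sigma0.comp₂ {P : M → M → Prop} (hP : Sigma0 fun e => P (e 0) (e 1))
    (t s : (ℕ → M) → M) [ht : TermDef t] [hs : TermDef s] : Sigma0 fun e => P (t e) (s e) :=
  hP.subst (push t fun _ => s) fun
    | 0 => ht
    | _ + 1 => hs

theorem Sigma0.comp₃ {P : M → M → M → Prop} (hP : Sigma0 fun e => P (e 0) (e 1) (e 2))
    (t s r : (ℕ → M) → M) [ht : TermDef t] [hs : TermDef s] [hr : TermDef r] :
    Sigma0 fun e => P (t e) (s e) (r e) :=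
  hP.subst (push t (push s fun _ => r)) fun
    | 0 => ht
    | 1 => hs
    | _ + 2 => hr

instance Sigma0.eq [ht : TermDef t] [hs : TermDef s] : Sigma0 fun e => t e = s e :=
  .of_eq ht hs

instance Sigma0.lt [ht : TermDef t] [hs : TermDef s] : Sigma0 fun e => t e < s e :=
  .of_lt ht hs

instance Sigma0.mem [ht : TermDef t] {X : Set M} [hX : Fact (X ∈ L2Structure.sets)] :
    Sigma0 fun e => t e ∈ X :=
  .of_mem ht hX.out

instance Sigma0.not [hP : Sigma0 P] : Sigma0 fun e => ¬ P e := hP.of_not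

instance Sigma0.imp [hP : Sigma0 P] [hQ : Sigma0 Q] : Sigma0 fun e => P e → Q e := hP.of_imp hQ

instance Sigma0.ballLT {P : M → (ℕ → M) → Prop} [ht : TermDef t]
    [hP : Sigma0 fun e => P (e 0) fun k => e (k + 1)] : Sigma0 fun e => ∀ x, x < t e → P x e :=
  .of_ballLT ht hP

instance Sigma0.or [Sigma0 P] [Sigma0 Q] : Sigma0 fun e => P e ∨ Q e :=
  Sigma0.congr (P := fun e => ¬ P e → Q e) inferInstance fun _ => or_iff_not_imp_left

instance Sigma0.and [Sigma0 P] [Sigma0 Q] : Sigma0 fun e => P e ∧ Q e :=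
  Sigma0.congr (P := fun e => ¬ (P e → ¬ Q e)) inferInstance fun _ => by tauto

instance Sigma0.iff [Sigma0 P] [Sigma0 Q] : Sigma0 fun e => P e ↔ Q e :=
  Sigma0.congr (P := fun e => (P e → Q e) ∧ (Q e → P e)) inferInstance fun _ => iff_def

instance Sigma0.const (p : Prop) : Sigma0 fun _ : ℕ → M => p := by
  by_cases hp : p
  · exact Sigma0.congr (P := fun _ => (0 : M) = 0) inferInstance fun _ => iff_of_true hp rfl
  · exact Sigma0.congr (P := fun _ => ¬ (0 : M) = 0) inferInstance fun _ => by simp [hp]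

instance Sigma0.bexLT {P : M → (ℕ → M) → Prop} [TermDef t]
    [Sigma0 fun e => P (e 0) fun k => e (k + 1)] : Sigma0 fun e => ∃ x, x < t e ∧ P x e :=
  Sigma0.congr (P := fun e => ¬ ∀ x, x < t e → ¬ P x e) inferInstance fun _ => by simp

/-- The predicates `∃ y, Q` with `Q` as in `Sigma0`. -/
class Sigma1 (P : (ℕ → M) → Prop) : Prop where
  exists_sigma0 : ∃ Q : M → (ℕ → M) → Prop, (Sigma0 fun e => Q (e 0) fun k => e (k + 1)) ∧
    ∀ e, P e ↔ ∃ y, Q y e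

theorem Sigma1.congr (hP : Sigma1 P) (h : ∀ e, Q e ↔ P e) : Sigma1 Q :=
  (funext fun e => propext (h e) : Q = P) ▸ hP

instance Sigma1.of_sigma0 [hP : Sigma0 P] : Sigma1 P :=
  ⟨fun _ => P, hP.subst _ fun k => .var (k + 1), fun _ => (exists_const M).symm⟩

instance Sigma1.or [hP : Sigma1 P] [hQ : Sigma1 Q] : Sigma1 fun e => P e ∨ Q e := by
  obtain ⟨P', _, hP'⟩ := hP
  obtain ⟨Q', _, hQ'⟩ := hQ
  exact ⟨fun y e => P' y e ∨ Q' y e, inferInstance, fun e => by simp only [hP', hQ', exists_or]⟩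

theorem Sigma1.subst (hP : Sigma1 P) (T : ℕ → (ℕ → M) → M) (hT : ∀ k, TermDef (T k)) :
    Sigma1 fun e => P fun k => T k e := by
  obtain ⟨Q, hQ, h⟩ := hP
  refine ⟨fun y e => Q y fun k => T k e, ?_, fun e => h fun k => T k e⟩
  exact hQ.subst (push (fun e => e 0) fun k e => T k fun j => e (j + 1)) fun
    | 0 => .var 0
    | k + 1 => (hT k).shift

theorem Sigma1.comp {P : M → Prop} (hP : Sigma1 fun e => P (e 0)) (t : (ℕ → M) → M)
    [ht : TermDef t] : Sigma1 fun e => P (t e) :=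
  hP.subst (fun _ => t) fun _ => ht

theorem Sigma1.comp₂ {P : M → M → Prop} (hP : Sigma1 fun e => P (e 0) (e 1))
    (t s : (ℕ → M) → M) [ht : TermDef t] [hs : TermDef s] : Sigma1 fun e => P (t e) (s e) :=
  hP.subst (push t fun _ => s) fun
    | 0 => ht
    | _ + 1 => hs

theorem Sigma1.exists_binary {P : M → Prop} (hP : Sigma1 fun e => P (e 0)) :
    ∃ R : M → M → Prop, (Sigma0 fun e => R (e 0) (e 1)) ∧ ∀ n, P n ↔ ∃ y, R n y := by
  obtain ⟨Q, hQ, h⟩ := hP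
  refine ⟨fun n y => Q y fun _ => n, ?_, fun n => h fun _ => n⟩
  exact hQ.subst (push (fun e => e 1) fun _ e => e 0) fun
    | 0 => .var 1
    | _ + 1 => .var 0

variable [Fact (DiscretelyOrderedSemiring M)]

instance Sigma0.le [TermDef t] [TermDef s] : Sigma0 fun e => t e ≤ s e :=
  Sigma0.congr (P := fun e => ¬ s e < t e) inferInstance fun _ => not_lt.symm

instance Sigma0.ballLE {P : M → (ℕ → M) → Prop} [TermDef t]
    [Sigma0 fun e => P (e 0) fun k => e (k + 1)] : Sigma0 fun e => ∀ x, x ≤ t e → P x e :=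
  Sigma0.congr (P := fun e => ∀ x, x < t e + 1 → P x e) inferInstance
    fun _ => by simp only [Order.lt_add_one_iff]

instance Sigma0.bexLE {P : M → (ℕ → M) → Prop} [TermDef t]
    [Sigma0 fun e => P (e 0) fun k => e (k + 1)] : Sigma0 fun e => ∃ x, x ≤ t e ∧ P x e :=
  Sigma0.congr (P := fun e => ∃ x, x < t e + 1 ∧ P x e) inferInstance
    fun _ => by simp only [Order.lt_add_one_iff]

instance Sigma0.dvd [ht : TermDef t] [hs : TermDef s] : Sigma0 fun e => t e ∣ s e := by
  have := ht.shift
  have := hs.shift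
  refine Sigma0.congr (P := fun e => ∃ q, q ≤ s e ∧ s e = t e * q) inferInstance fun e => ?_
  refine ⟨fun ⟨q, hq⟩ => ?_, fun ⟨q, _, hq⟩ => ⟨q, hq⟩⟩
  obtain h | h := eq_zero_or_pos (t e)
  · exact ⟨0, zero_le, by rw [hq, h, zero_mul, zero_mul]⟩
  · exact ⟨q, hq ▸ le_mul_of_one_le_left' (Order.one_le_iff_pos.2 h), hq⟩

instance Sigma1.ex {P : M → (ℕ → M) → Prop} [hP : Sigma1 fun e => P (e 0) fun k => e (k + 1)] :
    Sigma1 fun e => ∃ x, P x e := by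
  obtain ⟨Q, hQ, h⟩ := hP
  refine ⟨fun w e => ∃ x, x ≤ w ∧ ∃ y, y ≤ w ∧ Q y (push x e), ?_, fun e => ?_⟩
  · have : Sigma0 fun e : ℕ → M => Q (e 0) (push (e 1) fun k => e (k + 3)) :=
      (hQ.subst (push (fun e => e 0) (push (fun e => e 1) fun k e => e (k + 3))) fun
        | 0 => .var 0
        | 1 => .var 1
        | k + 2 => .var (k + 3)).congr fun e => iff_of_eq <| congrArg (Q (e 0)) <| funext fun
          | 0 => rfl
          | _ + 1 => rfl
    infer_instance
  · refine (exists_congr fun x => h (push x e)).trans ⟨fun ⟨x, y, hy⟩ => ?_, ?_⟩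
    · exact ⟨max x y, x, le_max_left .., y, le_max_right .., hy⟩
    · exact fun ⟨_, x, _, y, _, hy⟩ => ⟨x, y, hy⟩

instance Sigma1.and [hP : Sigma1 P] [hQ : Sigma1 Q] : Sigma1 fun e => P e ∧ Q e := by
  obtain ⟨P', hP, hP'⟩ := hP
  obtain ⟨Q', hQ, hQ'⟩ := hQ
  have : Sigma1 fun e => ∃ x, ∃ y, P' x e ∧ Q' y e := by
    have : Sigma0 fun e => P' (e 1) fun k => e (k + 2) :=
      hP.subst (fun k e => e (k + 1)) fun k => .var (k + 1)
    have : Sigma0 fun e => Q' (e 0) fun k => e (k + 2) :=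
      hQ.subst (push (fun e => e 0) fun k e => e (k + 2)) fun
        | 0 => .var 0
        | k + 1 => .var (k + 2)
    infer_instance
  exact this.congr fun e => by simp only [hP', hQ', exists_and_left, exists_and_right]

end Closure
end Definability

/-! ### The schemes of `RCA₀` for definable predicates -/

/-- A slot for each number variable of a formula: it holds either one of the variables of a
predicate on `ℕ → M` or a parameter from `M`. -/
abbrev Slots (M : Type u) : Type u := ℕ → ℕ ⊕ M

/-- The assignment that reads the variables from `e` and the parameters from the slots. -/
def Slots.assign {M : Type u} (v : Slots M) (e : ℕ → M) (k : ℕ) : M := (v k).elim e id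

/-- The sequence with the terms of `f` at the even and those of `g` at the odd places. -/
def interleave {α : Type*} (f g : ℕ → α) : ℕ → α := Sum.elim f g ∘ Equiv.natSumNatEquivNat.symm

theorem interleave_comp_even {α : Type*} (f g : ℕ → α) : (interleave f g ∘ fun k => 2 * k) = f :=
  funext fun k => congrArg (Sum.elim f g) (Equiv.natSumNatEquivNat.symm_apply_apply (.inl k))

theorem interleave_comp_odd {α : Type*} (f g : ℕ → α) : (interleave f g ∘ fun k => 2 * k + 1) = g :=
  funext fun k => congrArg (Sum.elim f g) (Equiv.natSumNatEquivNat.symm_apply_apply (.inr k))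

theorem forall_interleave_mem {α : Type*} {S : Set α} {f g : ℕ → α} (hf : ∀ k, f k ∈ S)
    (hg : ∀ k, g k ∈ S) (k : ℕ) : interleave f g k ∈ S := by
  unfold interleave
  rw [Function.comp_apply]
  cases Equiv.natSumNatEquivNat.symm k
  exacts [hf _, hg _]

theorem Slots.assign_comp {M : Type u} (v : Slots M) (e : ℕ → M) (ρ : ℕ → ℕ) :
    v.assign e ∘ ρ = Slots.assign (v ∘ ρ) e := rfl

/-- The variables of the body of a quantifier, given by the slots `v`, in terms of the bound
variable and the slots `v.outer`. -/
def Slots.underBinder {M : Type u} (v : Slots M) (k : ℕ) : ℕ :=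
  match v k with
  | .inl 0 => 0
  | _ => k + 1

/-- The slots outside a quantifier whose body has the slots `v`. -/
def Slots.outer {M : Type u} (v : Slots M) : Slots M := Sum.map Nat.pred id ∘ v

theorem Slots.push_assign_comp_underBinder {M : Type u} (v : Slots M) (x : M) (e : ℕ → M) :
    push x (v.outer.assign e) ∘ v.underBinder = v.assign (push x e) := by
  funext k
  simp only [Function.comp_apply, underBinder, assign]
  rcases h : v k with (_ | j) | c <;> simp [push, assign, outer, h]

/-- The renaming of the variables given by the slots `v` to the variables of an instance of a
scheme: the variable of the scheme, one quantified variable, and parameters. -/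
def Slots.toScheme {M : Type u} (v : Slots M) (k : ℕ) : ℕ :=
  match v k with
  | .inl 0 => 1
  | .inl _ => 0
  | .inr _ => k + 2

/-- The parameters that fill the slots `v`. -/
def Slots.param {M : Type u} [Zero M] (v : Slots M) (k : ℕ) : M := (v k).elim 0 id

theorem Slots.push_param_comp_toScheme {M : Type u} [Zero M] (v : Slots M) (n y : M) :
    push y (push n v.param) ∘ v.toScheme = v.assign (push n fun _ => y) := by
  funext k
  simp only [Function.comp_apply, toScheme, assign]
  rcases h : v k with (_ | j) | c <;> simp [push, param, h]

section

variable {M : Type u} [L2Structure M]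

/-- The function `t` is the value of the term `τ` with slots `v`. -/
def Term.Defines (τ : Term) (v : Slots M) (t : (ℕ → M) → M) : Prop :=
  ∀ e, t e = τ.val (v.assign e)

/-- The predicate `P` is defined by the `Σ⁰₀` formula `φ` with slots `v` and set parameters `E`. -/
structure Formula.Defines (φ : Formula) (v : Slots M) (E : ℕ → Set M) (P : (ℕ → M) → Prop) :
    Prop where
  isSigma00 : φ.IsSigma00
  mem_sets : ∀ k, E k ∈ L2Structure.sets
  iff_holds : ∀ e, P e ↔ φ.Holds (v.assign e) E

theorem Term.Defines.exists_common {τ σ : Term} {v w : Slots M} {t s : (ℕ → M) → M}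
    (ht : τ.Defines v t) (hs : σ.Defines w s) :
    ∃ (τ' σ' : Term) (u : Slots M), τ'.Defines u t ∧ σ'.Defines u s := by
  refine ⟨τ.rename fun k => 2 * k, σ.rename fun k => 2 * k + 1, interleave v w, fun e => ?_,
    fun e => ?_⟩
  · rw [Term.val_rename, Slots.assign_comp, interleave_comp_even, ht]
  · rw [Term.val_rename, Slots.assign_comp, interleave_comp_odd, hs]

theorem Formula.Defines.exists_common {φ ψ : Formula} {v w : Slots M} {E F : ℕ → Set M}
    {P Q : (ℕ → M) → Prop} (hP : φ.Defines v E P) (hQ : ψ.Defines w F Q) :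
    ∃ (φ' ψ' : Formula) (u : Slots M) (G : ℕ → Set M),
      φ'.Defines u G P ∧ ψ'.Defines u G Q := by
  refine ⟨φ.rename (fun k => 2 * k) fun k => 2 * k,
    ψ.rename (fun k => 2 * k + 1) fun k => 2 * k + 1, interleave v w, interleave E F,
    ⟨hP.isSigma00.rename _ _, forall_interleave_mem hP.mem_sets hQ.mem_sets, fun e => ?_⟩,
    ⟨hQ.isSigma00.rename _ _, forall_interleave_mem hP.mem_sets hQ.mem_sets, fun e => ?_⟩⟩
  · rw [Formula.holds_rename, Slots.assign_comp, interleave_comp_even, interleave_comp_even,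
      hP.iff_holds]
  · rw [Formula.holds_rename, Slots.assign_comp, interleave_comp_odd, interleave_comp_odd,
      hQ.iff_holds]

theorem TermDef.exists_term {t : (ℕ → M) → M} (ht : TermDef t) :
    ∃ (τ : Term) (v : Slots M), τ.Defines v t := by
  induction ht with
  | const c => exact ⟨.var 0, fun _ => .inr c, fun _ => rfl⟩
  | var i => exact ⟨.var i, .inl, fun _ => rfl⟩
  | of_add _ _ iht ihs =>
    obtain ⟨_, _, ht⟩ := iht
    obtain ⟨_, _, hs⟩ := ihs
    obtain ⟨τ, σ, v, ht, hs⟩ := ht.exists_common hs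
    exact ⟨.add τ σ, v, fun e => congrArg₂ (· + ·) (ht e) (hs e)⟩
  | of_mul _ _ iht ihs =>
    obtain ⟨_, _, ht⟩ := iht
    obtain ⟨_, _, hs⟩ := ihs
    obtain ⟨τ, σ, v, ht, hs⟩ := ht.exists_common hs
    exact ⟨.mul τ σ, v, fun e => congrArg₂ (· * ·) (ht e) (hs e)⟩

theorem TermDef.exists_terms {t s : (ℕ → M) → M} (ht : TermDef t) (hs : TermDef s) :
    ∃ (τ σ : Term) (v : Slots M), τ.Defines v t ∧ σ.Defines v s := by
  obtain ⟨_, _, ht⟩ := ht.exists_term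
  obtain ⟨_, _, hs⟩ := hs.exists_term
  exact ht.exists_common hs

theorem exists_setAssignment : ∃ E : ℕ → Set M, ∀ k, E k ∈ L2Structure.sets :=
  L2Structure.sets_nonempty.elim fun X hX => ⟨fun _ => X, fun _ => hX⟩

theorem Formula.Defines.ballLT {τ : Term} {φ : Formula} {v w : Slots M} {E : ℕ → Set M}
    {t : (ℕ → M) → M} {P : M → (ℕ → M) → Prop} (ht : τ.Defines v t)
    (hP : φ.Defines w E fun e => P (e 0) fun k => e (k + 1)) :
    (Formula.ballLT (τ.rename fun k => 2 * k)
        ((φ.rename w.underBinder id).rename (liftRename fun k => 2 * k + 1) id)).Defines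
      (interleave v w.outer) E fun e => ∀ x, x < t e → P x e := by
  refine ⟨.ballLT _ ((hP.isSigma00.rename _ _).rename _ _), hP.mem_sets, fun e => ?_⟩
  refine forall_congr' fun x => imp_congr ?_ ?_
  · change _ ↔ x < (Term.shift _).val (push x _)
    rw [Term.val_shift, Term.val_rename, Slots.assign_comp, interleave_comp_even, ht]
  · simp only [Formula.holds_rename, push_comp_liftRename, Slots.assign_comp,
      interleave_comp_odd, Slots.push_assign_comp_underBinder]
    exact hP.iff_holds (push x e)

theorem Sigma0.exists_formula {P : (ℕ → M) → Prop} (hP : Sigma0 P) :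
    ∃ (φ : Formula) (v : Slots M) (E : ℕ → Set M), φ.Defines v E P := by
  induction hP with
  | of_eq ht hs =>
    obtain ⟨τ, σ, v, ht, hs⟩ := ht.exists_terms hs
    obtain ⟨E, hE⟩ := exists_setAssignment (M := M)
    exact ⟨.eq τ σ, v, E, .eq _ _, hE, fun e => by simp only [ht e, hs e]; rfl⟩
  | of_lt ht hs =>
    obtain ⟨τ, σ, v, ht, hs⟩ := ht.exists_terms hs
    obtain ⟨E, hE⟩ := exists_setAssignment (M := M)
    exact ⟨.lt τ σ, v, E, .lt _ _, hE, fun e => by simp only [ht e, hs e]; rfl⟩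
  | @of_mem t X ht hX =>
    obtain ⟨τ, v, ht⟩ := ht.exists_term
    exact ⟨.mem τ 0, v, fun _ => X, .mem _ _, fun _ => hX, fun e => by simp only [ht e]; rfl⟩
  | of_not _ ih =>
    obtain ⟨φ, v, E, hφ, hE, h⟩ := ih
    exact ⟨.neg φ, v, E, .neg hφ, hE, fun e => not_congr (h e)⟩
  | of_imp _ _ ih₁ ih₂ =>
    obtain ⟨_, _, _, hP⟩ := ih₁
    obtain ⟨_, _, _, hQ⟩ := ih₂
    obtain ⟨φ, ψ, v, E, ⟨hφ, hE, hP⟩, ⟨hψ, -, hQ⟩⟩ := hP.exists_common hQ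
    exact ⟨.imp φ ψ, v, E, .imp hφ hψ, hE, fun e => imp_congr (hP e) (hQ e)⟩
  | of_ballLT ht _ ih =>
    obtain ⟨_, _, ht⟩ := ht.exists_term
    obtain ⟨_, _, _, hP⟩ := ih
    exact ⟨_, _, _, .ballLT ht hP⟩

theorem holds_rename_toScheme (φ : Formula) (v : Slots M) (E : ℕ → Set M) (n y : M) :
    (φ.rename v.toScheme id).Holds (push y (push n v.param)) E ↔
      φ.Holds (v.assign (push n fun _ => y)) E := by
  rw [Formula.holds_rename, Slots.push_param_comp_toScheme, Function.comp_id]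

theorem Formula.Defines.holds_all {φ : Formula} {v : Slots M} {E : ℕ → Set M} {P : M → M → Prop}
    (h : φ.Defines v E fun e => P (e 0) (e 1)) (n : M) :
    (Formula.all (φ.rename v.toScheme id)).Holds (push n v.param) E ↔ ∀ y, P n y :=
  forall_congr' fun y =>
    (holds_rename_toScheme φ v E n y).trans (h.iff_holds (push n fun _ => y)).symm

theorem Formula.Defines.holds_ex {φ : Formula} {v : Slots M} {E : ℕ → Set M} {P : M → M → Prop}
    (h : φ.Defines v E fun e => P (e 0) (e 1)) (n : M) :
    (Formula.ex (φ.rename v.toScheme id)).Holds (push n v.param) E ↔ ∃ y, P n y :=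
  Iff.trans (not_congr (forall_congr' fun y => not_congr
    ((holds_rename_toScheme φ v E n y).trans (h.iff_holds (push n fun _ => y)).symm)))
    not_forall_not

end

instance {M : Type u} [L2Structure M] [hM : Fact (IsModelRCA0 M)] :
    Fact (DiscretelyOrderedSemiring M) :=
  ⟨hM.out.semiring⟩

section

variable {M : Type u} [L2Structure M] [hM : Fact (IsModelRCA0 M)]

theorem sigma1_induction (P : M → Prop) [hP : Sigma1 fun e => P (e 0)] (zero : P 0)
    (succ : ∀ n, P n → P (n + 1)) (n : M) : P n := by
  obtain ⟨R, hR, h⟩ := hP.exists_binary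
  obtain ⟨φ, v, E, hφ⟩ := hR.exists_formula
  have := hM.out.sigma01_induction _ ⟨_, hφ.isSigma00.rename v.toScheme id, rfl⟩ v.param E
    hφ.mem_sets
  simp only [hφ.holds_ex, ← h] at this
  exact this zero succ n

theorem delta1_comprehension (P : M → Prop) [hP : Sigma1 fun e => P (e 0)]
    [hP' : Sigma1 fun e => ¬ P (e 0)] : {n | P n} ∈ L2Structure.sets := by
  obtain ⟨R, hR, h⟩ := hP.exists_binary
  obtain ⟨S, hS, h'⟩ := Sigma1.exists_binary (P := fun n => ¬ P n) hP'
  obtain ⟨_, _, _, hR⟩ := hR.exists_formula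
  obtain ⟨_, _, _, hS⟩ := hS.of_not.exists_formula
  obtain ⟨φ, ψ, v, E, hφ, hψ⟩ := hR.exists_common hS
  obtain ⟨X, hX, hX'⟩ := hM.out.delta01_comprehension _ _
    ⟨_, hφ.isSigma00.rename v.toScheme id, rfl⟩ ⟨_, hψ.isSigma00.rename v.toScheme id, rfl⟩
    v.param E hφ.mem_sets fun n => by
      rw [hφ.holds_ex, Formula.Defines.holds_all (P := fun n y => ¬ S n y) hψ, ← h, ← not_exists,
        ← h', not_not]
  convert hX
  ext n
  rw [hX', hφ.holds_ex, ← h]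
  rfl

theorem setOf_mem_sets (P : M → Prop) [Sigma0 fun e => P (e 0)] :
    {n | P n} ∈ L2Structure.sets :=
  delta1_comprehension P

theorem Sigma0.of_delta1 {P : M → M → Prop} (hP : Sigma1 fun e => P (e 0) (e 1))
    (hP' : Sigma1 fun e => ¬ P (e 0) (e 1)) : Sigma0 fun e => P (e 0) (e 1) := by
  have mem_iff (p : M) : (∃ a b, p = pair a b ∧ P a b) ↔
      ¬ ((∀ a, a ≤ p → ∀ b, b ≤ p → p ≠ pair a b) ∨ ∃ a b, p = pair a b ∧ ¬ P a b) := by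
    constructor
    · rintro ⟨a, b, rfl, h⟩ (h' | ⟨a', b', hp, h'⟩)
      · exact h' a (left_le_pair ..) b (right_le_pair ..) rfl
      · obtain ⟨rfl, rfl⟩ := pair_inj.1 hp
        exact h' h
    · intro h
      push Not at h
      obtain ⟨⟨a, -, b, -, rfl⟩, h⟩ := h
      exact ⟨a, b, rfl, h a b rfl⟩
  have := hP.comp₂
  have := Sigma1.comp₂ (P := fun a b => ¬ P a b) hP'
  have : Sigma1 fun e : ℕ → M => ¬ ∃ a b, e 0 = pair a b ∧ P a b := by
    simp only [mem_iff, not_not]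
    infer_instance
  have hX := delta1_comprehension fun p => ∃ a b, p = pair a b ∧ P a b
  refine (Sigma0.of_mem (inferInstanceAs (TermDef fun e => pair (e 0) (e 1))) hX).congr
    fun e => ⟨fun h => ⟨_, _, rfl, h⟩, ?_⟩
  rintro ⟨a, b, h, hab⟩
  obtain ⟨h₀, h₁⟩ := pair_inj.1 h
  rwa [h₀, h₁]

/-- The functions of the structure, that is, the functions `M → M` whose graph can be defined by a
`Σ⁰₀` formula with parameters. -/
class FunDef (f : M → M) : Prop where
  sigma0_graph : Sigma0 fun e => f (e 0) = e 1

instance Sigma0.fun_eq {f : M → M} {t s : (ℕ → M) → M} [hf : FunDef f] [TermDef t] [TermDef s] :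
    Sigma0 fun e => f (t e) = s e :=
  Sigma0.comp₂ (P := fun x y => f x = y) hf.sigma0_graph t s

theorem Sigma0.comp_fun {R : M → M → Prop} (hR : Sigma0 fun e => R (e 0) (e 1)) (f g : M → M)
    [FunDef f] [FunDef g] : Sigma0 fun e => R (f (e 0)) (g (e 1)) := by
  have := hR.comp₂
  refine .of_delta1 (P := fun x y => R (f x) (g y))
    (.congr (P := fun e => ∃ a b, f (e 0) = a ∧ g (e 1) = b ∧ R a b) inferInstance ?_)
    (.congr (P := fun e => ∃ a b, f (e 0) = a ∧ g (e 1) = b ∧ ¬ R a b) inferInstance ?_)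
  all_goals simp

instance Sigma0.fun_lt_fun {f g : M → M} {t s : (ℕ → M) → M} [FunDef f] [FunDef g] [TermDef t]
    [TermDef s] : Sigma0 fun e => f (t e) < g (s e) :=
  Sigma0.comp₂ (P := fun x y => f x < g y) (Sigma0.comp_fun inferInstance f g) t s

instance Sigma0.fun_le_fun {f g : M → M} {t s : (ℕ → M) → M} [FunDef f] [FunDef g] [TermDef t]
    [TermDef s] : Sigma0 fun e => f (t e) ≤ g (s e) :=
  Sigma0.comp₂ (P := fun x y => f x ≤ g y) (Sigma0.comp_fun inferInstance f g) t s

instance FunDef.pair {f g : M → M} [FunDef f] [FunDef g] :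
    FunDef fun x => SecondOrderArithmetic.pair (f x) (g x) := by
  refine ⟨.congr (P := fun e => ∃ a, a ≤ e 1 ∧ ∃ b, b ≤ e 1 ∧ (f (e 0) = a ∧ (g (e 0) = b ∧
    SecondOrderArithmetic.pair a b = e 1))) inferInstance fun e => ⟨fun h => ?_, ?_⟩⟩
  · rw [← h]
    exact ⟨_, left_le_pair .., _, right_le_pair .., rfl, rfl, rfl⟩
  · rintro ⟨_, -, _, -, rfl, rfl, h⟩
    exact h

end

section

variable {M : Type u} [L2Structure M] [hM : Fact (IsModelRCA0 M)]

theorem exists_least (P : M → Prop) [hP : Sigma1 fun e => P (e 0)] (h : ∃ n, P n) :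
    ∃ n, P n ∧ ∀ n' < n, ¬ P n' := by
  obtain ⟨N, hN⟩ := h
  by_contra! hc
  have := hP.comp
  have descent (i : M) : ∃ z, z + i ≤ N ∧ P z := by
    refine sigma1_induction (fun i => ∃ z, z + i ≤ N ∧ P z) ⟨N, by simp, hN⟩ ?_ i
    rintro i ⟨z, hz, h⟩
    obtain ⟨z', hz', h'⟩ := hc z h
    refine ⟨z', ?_, h'⟩
    calc z' + (i + 1) = z' + 1 + i := by ring
      _ ≤ z + i := by
        have := Order.add_one_le_iff.2 hz'
        gcongr
      _ ≤ N := hz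
  obtain ⟨z, hz, -⟩ := descent (N + 1)
  exact (lt_add_one N).not_ge (le_add_self.trans hz)

theorem exists_greatest (P : M → Prop) [hP : Sigma0 fun e => P (e 0)] (b : M)
    (h : ∃ n ≤ b, P n) : ∃ n ≤ b, P n ∧ ∀ n' ≤ b, P n' → n' ≤ n := by
  have := hP.comp
  have complement {n : M} (hn : n ≤ b) (hPn : P n) : ∃ d, ∃ n, n ≤ b ∧ n + d = b ∧ P n :=
    (exists_add_of_le hn).imp fun _ hd => ⟨n, hn, hd.symm, hPn⟩
  obtain ⟨d, ⟨n, hn, hnd, hPn⟩, hmin⟩ := exists_least _ (h.elim fun n h => complement h.1 h.2)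
  refine ⟨n, hn, hPn, fun n' hn' hPn' => ?_⟩
  obtain ⟨d', hd'⟩ := exists_add_of_le hn'
  have hdd' : d ≤ d' := not_lt.1 fun h => hmin d' h ⟨n', hn', hd'.symm, hPn'⟩
  exact not_lt.1 fun h => (add_lt_add_of_lt_of_le h hdd').ne (hnd.trans hd')

end

/-! ### Finite sets -/

section

variable {M : Type u} [L2Structure M] [hM : Fact (DiscretelyOrderedSemiring M)]

theorem dvd_of_dvd_add_of_dvd_left {d x y : M} (h : d ∣ x + y) (hx : d ∣ x) : d ∣ y := by
  obtain ⟨q, rfl⟩ := hx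
  obtain ⟨r, hr⟩ := h
  obtain hq | hq := le_total q r
  · obtain ⟨z, rfl⟩ := exists_add_of_le hq
    rw [mul_add] at hr
    exact ⟨z, add_left_cancel hr⟩
  · have : d * q + y ≤ d * q := hr.le.trans (mul_le_mul_right hq d)
    rw [nonpos_iff_eq_zero.1 ((add_le_iff_nonpos_right _).1 this)]
    exact dvd_zero d

theorem add_one_pos (x : M) : 0 < x + 1 := zero_lt_one.trans_le le_add_self

theorem modulus_not_dvd_one {m : M} (hm : 0 < m) (i : M) : ¬ m * (i + 1) + 1 ∣ 1 := by
  rintro ⟨q, hq⟩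
  have hq₀ : 0 < q := pos_iff_ne_zero.2 <| by
    rintro rfl
    exact one_ne_zero (hq.trans (mul_zero _))
  have one_lt : 1 < m * (i + 1) + 1 := lt_add_of_pos_left 1 (mul_pos hm (add_one_pos i))
  exact (one_lt.trans_le (le_mul_of_one_le_right' (Order.one_le_iff_pos.2 hq₀))).ne hq

theorem exists_add_eq_of_lt_of_forall_dvd {m k i j : M} (hm : ∀ i < k, i + 1 ∣ m) (hj : j < k)
    (hij : i < j) : ∃ z, z ∣ m ∧ i + z = j := by
  obtain ⟨y, rfl⟩ := exists_add_of_le (Order.add_one_le_iff.2 hij)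
  have hy : y < i + 1 + y := lt_add_of_pos_left _ (by simp)
  exact ⟨y + 1, hm y (hy.trans hj), by ring⟩

/-- Both moduli are coprime to `m`, and their indices differ by a divisor `z` of `m`; hence they
are coprime. -/
theorem dvd_of_dvd_mul_modulus {m k i j a : M} (hm : ∀ i < k, i + 1 ∣ m) (hi : i < k)
    (hj : j < k) (hij : i ≠ j) (h : m * (j + 1) + 1 ∣ a * (m * (i + 1) + 1)) :
    m * (j + 1) + 1 ∣ a := by
  obtain ⟨z, hzm, hz⟩ : ∃ z, z ∣ m ∧ m * (j + 1) + 1 ∣ a * z := by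
    obtain hij | hij := lt_or_gt_of_ne hij
    · obtain ⟨z, hzm, rfl⟩ := exists_add_eq_of_lt_of_forall_dvd hm hj hij
      refine ⟨z, hzm, dvd_of_dvd_add_of_dvd_left ?_ (dvd_mul_left _ (a * (i + 1)))⟩
      convert h.mul_left (i + z + 1) using 1
      ring
    · obtain ⟨z, hzm, rfl⟩ := exists_add_eq_of_lt_of_forall_dvd hm hi hij
      refine ⟨z, hzm, dvd_of_dvd_add_of_dvd_left ?_ (h.mul_left (j + 1))⟩
      convert dvd_mul_left (m * (j + 1) + 1) (a * (j + z + 1)) using 1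
      ring
  have ham : m * (j + 1) + 1 ∣ a * m * (j + 1) := (hz.trans (mul_dvd_mul_left a hzm)).mul_right _
  refine dvd_of_dvd_add_of_dvd_left ?_ ham
  convert dvd_mul_left (m * (j + 1) + 1) a using 1
  ring

theorem finMem_pair_iff {k m n i : M} :
    FinMem i (pair k (pair m n)) ↔ i < k ∧ m * (i + 1) + 1 ∣ n := by
  constructor
  · rintro ⟨k', m', n', h, hi, hq⟩
    obtain ⟨rfl, h'⟩ := pair_inj.1 h
    obtain ⟨rfl, rfl⟩ := pair_inj.1 h'
    exact ⟨hi, hq⟩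
  · exact fun ⟨hi, hq⟩ => ⟨k, m, n, rfl, hi, hq⟩

theorem FinMem.lt {i c : M} (h : FinMem i c) : i < c := by
  obtain ⟨k, m, n, rfl, hi, -⟩ := h
  exact hi.trans_le (left_le_pair ..)

theorem middle_le_pair_pair (k m n : M) : m ≤ pair k (pair m n) :=
  (left_le_pair ..).trans (right_le_pair ..)

theorem right_le_pair_pair (k m n : M) : n ≤ pair k (pair m n) :=
  (right_le_pair ..).trans (right_le_pair ..)

instance Sigma0.isTriple {t : (ℕ → M) → M} [TermDef t] : Sigma0 fun e => IsTriple (t e) := by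
  refine Sigma0.comp (.congr (P := fun e => ∃ k, k ≤ e 0 ∧ ∃ m, m ≤ e 0 ∧ ∃ n, n ≤ e 0 ∧
    e 0 = pair k (pair m n)) inferInstance fun e => ⟨?_, ?_⟩) t
  · rintro ⟨k, m, n, h⟩
    rw [h]
    exact ⟨k, left_le_pair .., m, middle_le_pair_pair .., n, right_le_pair_pair .., rfl⟩
  · rintro ⟨k, -, m, -, n, -, h⟩
    exact ⟨k, m, n, h⟩

instance Sigma0.finMem {t s : (ℕ → M) → M} [TermDef t] [TermDef s] :
    Sigma0 fun e => FinMem (t e) (s e) := by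
  refine Sigma0.comp₂ (.congr (P := fun e => ∃ k, k ≤ e 1 ∧ ∃ m, m ≤ e 1 ∧ ∃ n, n ≤ e 1 ∧
    (e 1 = pair k (pair m n) ∧ (e 0 < k ∧ m * (e 0 + 1) + 1 ∣ n))) inferInstance
      fun e => ⟨?_, ?_⟩) t s
  · rintro ⟨k, m, n, h, hi, hq⟩
    rw [h]
    exact ⟨k, left_le_pair .., m, middle_le_pair_pair .., n, right_le_pair_pair .., rfl, hi, hq⟩
  · rintro ⟨k, -, m, -, n, -, h, hi, hq⟩
    exact ⟨k, m, n, h, hi, hq⟩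

/-- The numbers `c` and `d` represent the same finite set. -/
def SameElements (c d : M) : Prop := ∀ i, FinMem i c ↔ FinMem i d

instance Sigma0.sameElements {t s : (ℕ → M) → M} [TermDef t] [TermDef s] :
    Sigma0 fun e => SameElements (t e) (s e) := by
  refine Sigma0.comp₂ (.congr (P := fun e => (∀ i, i < e 0 → FinMem i (e 0) → FinMem i (e 1)) ∧
    ∀ i, i < e 1 → FinMem i (e 1) → FinMem i (e 0)) inferInstance fun e => ⟨fun h => ?_, ?_⟩) t s
  · exact ⟨fun i _ => (h i).1, fun i _ => (h i).2⟩
  · exact fun ⟨h, h'⟩ i => ⟨fun hi => h i hi.lt hi, fun hi => h' i hi.lt hi⟩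

instance Sigma0.isFinCode {t : (ℕ → M) → M} [TermDef t] : Sigma0 fun e => IsFinCode (t e) :=
  Sigma0.comp (.congr (P := fun e => IsTriple (e 0) ∧
    ∀ d, d < e 0 → IsTriple d → ¬ SameElements d (e 0)) inferInstance fun _ => Iff.rfl) t

/-- The number `c` is the code of the finite set `X`. -/
def Codes (c : M) (X : Set M) : Prop := IsFinCode c ∧ ∀ i, FinMem i c ↔ i ∈ X

theorem Codes.unique {c d : M} {X : Set M} (hc : Codes c X) (hd : Codes d X) : c = d := by
  have h : SameElements c d := fun i => (hc.2 i).trans (hd.2 i).symm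
  obtain hlt | heq | hlt := lt_trichotomy c d
  · exact absurd h (hd.1.2 c hlt hc.1.1)
  · exact heq
  · exact absurd (fun i => (h i).symm) (hc.1.2 d hlt hd.1.1)

end

section

variable {M : Type u} [L2Structure M] [hM : Fact (IsModelRCA0 M)]

theorem exists_common_multiple (k : M) : ∃ m : M, 0 < m ∧ ∀ i < k, i + 1 ∣ m := by
  refine sigma1_induction (fun k => ∃ m, 0 < m ∧ ∀ i, i < k → i + 1 ∣ m)
    ⟨1, zero_lt_one, fun i hi => absurd hi not_lt_zero⟩ ?_ k
  rintro n ⟨m, hm₀, hm⟩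
  refine ⟨m * (n + 1), mul_pos hm₀ (add_one_pos n), fun i hi => ?_⟩
  obtain rfl | hi := (Order.lt_add_one_iff.1 hi).eq_or_lt
  · exact dvd_mul_left _ _
  · exact (hm i hi).mul_right _

theorem exists_modulus_dvd_iff (P : M → Prop) [hP : Sigma0 fun e => P (e 0)] {m k : M}
    (hm₀ : 0 < m) (hm : ∀ i < k, i + 1 ∣ m) :
    ∃ n : M, 0 < n ∧ ∀ i < k, m * (i + 1) + 1 ∣ n ↔ P i := by
  have := hP.comp
  suffices ∃ n : M, 0 < n ∧ ∀ i < k, m * (i + 1) + 1 ∣ n ↔ i < k ∧ P i from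
    this.imp fun n ⟨hn₀, hn⟩ => ⟨hn₀, fun i hi => (hn i hi).trans (and_iff_right hi)⟩
  refine sigma1_induction
    (fun l => ∃ n, 0 < n ∧ ∀ i, i < k → (m * (i + 1) + 1 ∣ n ↔ i < l ∧ P i))
    ⟨1, zero_lt_one, fun i _ => iff_of_false (modulus_not_dvd_one hm₀ i) (by simp)⟩ ?_ k
  rintro l ⟨n, hn₀, hn⟩
  by_cases hl : l < k ∧ P l
  · refine ⟨n * (m * (l + 1) + 1), mul_pos hn₀ (add_one_pos _), fun i hi => ?_⟩
    obtain rfl | hli := eq_or_ne l i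
    · exact iff_of_true (dvd_mul_left _ _) ⟨lt_add_one _, hl.2⟩
    · rw [Order.lt_add_one_iff, le_iff_eq_or_lt, or_iff_right hli.symm, ← hn i hi]
      exact ⟨dvd_of_dvd_mul_modulus hm hl.1 hi hli, fun h => h.mul_right _⟩
  · refine ⟨n, hn₀, fun i hi => ?_⟩
    rw [hn i hi, Order.lt_add_one_iff, le_iff_eq_or_lt, or_and_right, or_iff_right]
    rintro ⟨rfl, h⟩
    exact hl ⟨hi, h⟩

theorem exists_codes (P : M → Prop) [hP : Sigma0 fun e => P (e 0)] (k : M)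
    (hk : ∀ i, P i → i < k) : ∃ c : M, Codes c {i | P i} := by
  obtain ⟨m, hm₀, hm⟩ := exists_common_multiple k
  obtain ⟨n, -, hn⟩ := exists_modulus_dvd_iff P hm₀ hm
  have finMem_iff (i : M) : FinMem i (pair k (pair m n)) ↔ P i := by
    rw [finMem_pair_iff]
    exact ⟨fun ⟨hi, h⟩ => (hn i hi).1 h, fun h => ⟨hk i h, (hn i (hk i h)).2 h⟩⟩
  obtain ⟨c, ⟨hc, hc'⟩, hmin⟩ := exists_least
    (fun c => IsTriple c ∧ SameElements c (pair k (pair m n))) ⟨_, ⟨k, m, n, rfl⟩, fun _ => Iff.rfl⟩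
  exact ⟨c, ⟨hc, fun d hd hd' hdc => hmin d hd ⟨hd', fun i => (hdc i).trans (hc' i)⟩⟩,
    fun i => (hc' i).trans (finMem_iff i)⟩

/-! ### Bounding -/

/-- The bound comes from the least product of moduli `m (y + 1) + 1` in which only those `y < k`
are missing that have a witness below some common bound. -/
theorem strong_bounding (P : M → M → Prop) [hP : Sigma0 fun e => P (e 0) (e 1)] (k : M) :
    ∃ b, ∀ y < k, (∃ i, P y i) → ∃ i < b, P y i := by
  have := hP.comp₂
  obtain ⟨m, hm₀, hm⟩ := exists_common_multiple k
  obtain ⟨a, ha₀, ha⟩ := exists_modulus_dvd_iff (fun _ => True) hm₀ hm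
  obtain ⟨n, ⟨b, hn₀, hb⟩, hmin⟩ := exists_least
    (fun n => ∃ b, 0 < n ∧ ∀ y, y < k → (∀ i, i < b → ¬ P y i) → m * (y + 1) + 1 ∣ n)
    ⟨a, 0, ha₀, fun y hy _ => (ha y hy).2 trivial⟩
  refine ⟨b, fun y hy ⟨i, hi⟩ => ?_⟩
  by_contra! hc
  obtain ⟨n', rfl⟩ := hb y hy hc
  have hn' : 0 < n' := pos_of_mul_pos_right hn₀ zero_le
  refine hmin n' ?_ ⟨max b (i + 1), hn', fun z hz hz' => ?_⟩
  · exact lt_mul_of_one_lt_left hn' (lt_add_of_pos_left _ (mul_pos hm₀ (add_one_pos y)))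
  · have hzy : y ≠ z := by
      rintro rfl
      exact hz' i ((lt_add_one i).trans_le (le_max_right ..)) hi
    refine dvd_of_dvd_mul_modulus hm hy hz hzy ?_
    rw [mul_comm n']
    exact hb z hz fun j hj => hz' j (hj.trans_le (le_max_left ..))

theorem collection (P : M → M → Prop) [Sigma0 fun e => P (e 0) (e 1)] (k : M)
    (h : ∀ y < k, ∃ i, P y i) : ∃ b, ∀ y < k, ∃ i < b, P y i :=
  (strong_bounding P k).imp fun _ hb y hy => hb y hy (h y hy)

theorem exists_forall_le_of_injective (f : M → M) [FunDef f] (hinj : Function.Injective f) (k : M) :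
    ∃ b, ∀ i, b ≤ i → k ≤ f i := by
  obtain ⟨b, hb⟩ := strong_bounding (fun y i => f i = y) k
  refine ⟨b, fun i hi => not_lt.1 fun hik => ?_⟩
  obtain ⟨j, hj, hji⟩ := hb _ hik ⟨i, rfl⟩
  exact hj.not_ge (hinj hji ▸ hi)

end

/-! ### Arithmetical comprehension from `Σ⁰₁` comprehension -/

/-- Comprehension for `Σ⁰₁` formulas with parameters. -/
def Sigma1Comprehension (M : Type u) [L2Structure M] : Prop :=
  ∀ P : M → Prop, (Sigma1 fun e => P (e 0)) → {n | P n} ∈ L2Structure.sets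

section

variable {M : Type u} [L2Structure M]

/-- The code `(x₀, (x₁, … (xₙ, 0)))` of a list of numbers. The values of the first few variables of
an assignment are coded in this way, so that adding a variable amounts to adding a component. -/
def listCode (l : List M) : M := l.foldr pair 0

/-- The set `X` is the extension of the predicate `P` on lists of length `N`. -/
def IsExtension (X : Set M) (N : ℕ) (P : List M → Prop) : Prop :=
  X ∈ L2Structure.sets ∧ ∀ l : List M, l.length = N → (listCode l ∈ X ↔ P l)

/-- The set `X` is the graph of the function `f` on lists of length `N`. -/
def IsGraph (X : Set M) (N : ℕ) (f : List M → M) : Prop :=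
  X ∈ L2Structure.sets ∧ ∀ l : List M, l.length = N → ∀ y, pair (listCode l) y ∈ X ↔ f l = y

variable [hM : Fact (IsModelRCA0 M)]

theorem exists_isGraph_var (e : ℕ → M) (N i : ℕ) :
    ∃ X : Set M, IsGraph X N fun l => l.foldr push e i := by
  induction N generalizing i with
  | zero =>
    refine ⟨_, setOf_mem_sets fun p => p = pair 0 (e i), fun l hl y => ?_⟩
    obtain rfl := List.length_eq_zero_iff.1 hl
    exact pair_inj.trans ((and_iff_right rfl).trans eq_comm)
  | succ N ih =>
    cases i with
    | zero =>
      refine ⟨_, setOf_mem_sets fun p => ∃ x, x ≤ p ∧ ∃ c, c ≤ p ∧ p = pair (pair x c) x,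
        fun l hl y => ?_⟩
      obtain ⟨x, l, rfl, -⟩ := List.exists_cons_of_length_eq_add_one hl
      constructor
      · rintro ⟨_, -, _, -, h⟩
        obtain ⟨h, rfl⟩ := pair_inj.1 h
        exact (pair_inj.1 h).1
      · rintro rfl
        exact ⟨x, right_le_pair .., listCode l, (right_le_pair x _).trans (left_le_pair ..), rfl⟩
    | succ i =>
      obtain ⟨X, hX, hX'⟩ := ih i
      have := Fact.mk hX
      refine ⟨_, setOf_mem_sets fun p => ∃ x, x ≤ p ∧ ∃ c, c ≤ p ∧ ∃ y, y ≤ p ∧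
        (p = pair (pair x c) y ∧ pair c y ∈ X), fun l hl y => ?_⟩
      obtain ⟨x, l, rfl, hl⟩ := List.exists_cons_of_length_eq_add_one hl
      refine Iff.trans ⟨?_, fun h => ?_⟩ (hX' l (by simpa using hl) y)
      · rintro ⟨_, -, _, -, _, -, h, hy⟩
        obtain ⟨h', rfl⟩ := pair_inj.1 h
        obtain ⟨-, rfl⟩ := pair_inj.1 h'
        exact hy
      · exact ⟨x, (left_le_pair x _).trans (left_le_pair ..), listCode l,
          (right_le_pair x _).trans (left_le_pair ..), y, right_le_pair .., rfl, h⟩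

theorem IsGraph.exists_map₂ (hS : Sigma1Comprehension M) {X Y : Set M} {N : ℕ} {f g : List M → M}
    (hX : IsGraph X N f) (hY : IsGraph Y N g) (op : M → M → M)
    [hop : Sigma0 fun e => op (e 0) (e 1) = e 2] :
    ∃ Z : Set M, IsGraph Z N fun l => op (f l) (g l) := by
  have := Fact.mk hX.1
  have := Fact.mk hY.1
  have := Sigma0.comp₃ (P := fun x y z => op x y = z) hop
  refine ⟨_, hS (fun p => ∃ c z x y, p = pair c z ∧ pair c x ∈ X ∧ pair c y ∈ Y ∧ op x y = z)
    inferInstance, fun l hl z => ⟨?_, fun h => ?_⟩⟩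
  · rintro ⟨_, _, x, y, h, hx, hy, hz⟩
    obtain ⟨rfl, rfl⟩ := pair_inj.1 h
    obtain rfl := (hX.2 l hl x).1 hx
    obtain rfl := (hY.2 l hl y).1 hy
    exact hz
  · exact ⟨listCode l, z, f l, g l, rfl, (hX.2 l hl _).2 rfl, (hY.2 l hl _).2 rfl, h⟩

theorem exists_isGraph_const (N : ℕ) (a : M) : ∃ X : Set M, IsGraph X N fun _ => a := by
  refine ⟨_, setOf_mem_sets fun p => ∃ c, c ≤ p ∧ p = pair c a, fun l _ y => ⟨?_, ?_⟩⟩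
  · exact fun ⟨_, _, h⟩ => (pair_inj.1 h).2.symm
  · rintro rfl
    exact ⟨_, left_le_pair .., rfl⟩

theorem exists_isGraph_term (hS : Sigma1Comprehension M) (e : ℕ → M) (N : ℕ) (t : Term) :
    ∃ X : Set M, IsGraph X N fun l => t.val (l.foldr push e) := by
  induction t with
  | var i => exact exists_isGraph_var e N i
  | zero => exact exists_isGraph_const N 0
  | one => exact exists_isGraph_const N 1
  | add t s iht ihs => exact iht.elim fun _ hX => ihs.elim fun _ hY => hX.exists_map₂ hS hY (· + ·)
  | mul t s iht ihs => exact iht.elim fun _ hX => ihs.elim fun _ hY => hX.exists_map₂ hS hY (· * ·)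

theorem IsGraph.exists_isExtension (hS : Sigma1Comprehension M) {X Y : Set M} {N : ℕ}
    {f g : List M → M} (hX : IsGraph X N f) (hY : IsGraph Y N g) (R : M → M → Prop)
    [hR : Sigma0 fun e => R (e 0) (e 1)] : ∃ Z : Set M, IsExtension Z N fun l => R (f l) (g l) := by
  have := Fact.mk hX.1
  have := Fact.mk hY.1
  have := hR.comp₂
  refine ⟨_, hS (fun c => ∃ x y, pair c x ∈ X ∧ pair c y ∈ Y ∧ R x y) inferInstance,
    fun l hl => ⟨?_, fun h => ?_⟩⟩
  · rintro ⟨x, y, hx, hy, h⟩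
    rwa [(hX.2 l hl x).1 hx, (hY.2 l hl y).1 hy]
  · exact ⟨f l, g l, (hX.2 l hl _).2 rfl, (hY.2 l hl _).2 rfl, h⟩

theorem Formula.IsArithmetical.exists_isExtension (hS : Sigma1Comprehension M) {φ : Formula}
    (hφ : φ.IsArithmetical) {E : ℕ → Set M} (hE : ∀ k, E k ∈ L2Structure.sets) (e : ℕ → M)
    (N : ℕ) : ∃ X : Set M, IsExtension X N fun l => φ.Holds (l.foldr push e) E := by
  induction φ generalizing N with
  | eq t s =>
    obtain ⟨X, hX⟩ := exists_isGraph_term hS e N t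
    obtain ⟨Y, hY⟩ := exists_isGraph_term hS e N s
    exact hX.exists_isExtension hS hY (· = ·)
  | lt t s =>
    obtain ⟨X, hX⟩ := exists_isGraph_term hS e N t
    obtain ⟨Y, hY⟩ := exists_isGraph_term hS e N s
    exact hX.exists_isExtension hS hY (· < ·)
  | mem t k =>
    have := Fact.mk (hE k)
    obtain ⟨X, hX⟩ := exists_isGraph_term hS e N t
    exact hX.exists_isExtension hS hX fun x _ => x ∈ E k
  | neg φ ih =>
    obtain ⟨X, hX, hX'⟩ := ih hφ N
    have := Fact.mk hX
    exact ⟨_, setOf_mem_sets fun c => c ∉ X, fun l hl => not_congr (hX' l hl)⟩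
  | imp φ ψ ihφ ihψ =>
    obtain ⟨X, hX, hX'⟩ := ihφ hφ.1 N
    obtain ⟨Y, hY, hY'⟩ := ihψ hφ.2 N
    have := Fact.mk hX
    have := Fact.mk hY
    exact ⟨_, setOf_mem_sets fun c => c ∈ X → c ∈ Y,
      fun l hl => imp_congr (hX' l hl) (hY' l hl)⟩
  | all φ ih =>
    obtain ⟨X, hX, hX'⟩ := ih hφ (N + 1)
    have := Fact.mk hX
    obtain ⟨Y, hY, hY'⟩ : ∃ Y ∈ L2Structure.sets, ∀ c, c ∈ Y ↔ ∃ x, pair x c ∉ X :=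
      ⟨_, hS (fun c => ∃ x, pair x c ∉ X) inferInstance, fun _ => Iff.rfl⟩
    have := Fact.mk hY
    refine ⟨_, setOf_mem_sets fun c => c ∉ Y, fun l hl => (not_congr (hY' _)).trans ?_⟩
    exact not_exists_not.trans (forall_congr' fun x => hX' (x :: l) (by simpa using hl))
  | allSet => exact hφ.elim

theorem isModelACA0_of_sigma1Comprehension (hS : Sigma1Comprehension M) : IsModelACA0 M where
  semiring := hM.out.semiring
  induction X hX zero succ :=
    have := Fact.mk hX
    sigma1_induction (· ∈ X) zero succ
  arithmetical_comprehension φ hφ e E hE := by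
    obtain ⟨X, hX, hX'⟩ := hφ.exists_isExtension hS hE e 1
    have := Fact.mk hX
    have : Sigma0 fun e => pair (e 0) 0 ∈ X := Sigma0.mem (t := fun e => pair (e 0) 0)
    exact ⟨_, setOf_mem_sets fun n => pair n 0 ∈ X, fun n => hX' [n] rfl⟩

end

/-! ### The order of stages and values -/

section

variable {M : Type u} [L2Structure M] [hM : Fact (DiscretelyOrderedSemiring M)]

/-- Some stage `k ≤ s` after `t` shows that `g t` is not the least value of `g` from `t` on. -/
def SeenFalse (g : M → M) (t s : M) : Prop := ∃ k, k ≤ s ∧ t < k ∧ g k < g t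

/-- The linear order of the stages of the enumeration `g` in which `t` precedes a later stage `s` if
and only if `t` is seen to be false at `s`. -/
def StageLe (g : M → M) (x y : M) : Prop :=
  x = y ∨ (x < y ∧ SeenFalse g x y) ∨ (y < x ∧ ¬ SeenFalse g y x)

/-- Comparison of `g u` and `g w`, except that `0` and `1` stand for two additional elements at the
top, with `1` above `0`. -/
def ValueLe (g : M → M) (u w : M) : Prop := w = 1 ∨ u ≠ 1 ∧ (w = 0 ∨ u ≠ 0 ∧ g u ≤ g w)

/-- The product of the order of stages and the order of values. -/
def stageValueOrder (g : M → M) : CodedRel M where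
  carrier := prodSet Set.univ Set.univ
  le := {p | ∃ x u y w, p = pair (pair x u) (pair y w) ∧ StageLe g x y ∧ ValueLe g u w}

variable {g : M → M}

theorem SeenFalse.mono {t s s' : M} (h : SeenFalse g t s) (hs : s ≤ s') : SeenFalse g t s' :=
  h.imp fun _ h => ⟨h.1.trans hs, h.2⟩

theorem SeenFalse.or {t s r : M} (hts : t < s) (h : SeenFalse g t r) :
    SeenFalse g t s ∨ SeenFalse g s r := by
  obtain ⟨k, hkr, htk, hg⟩ := h
  obtain hks | hsk := le_or_gt k s
  · exact .inl ⟨k, hks, htk, hg⟩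
  · obtain hgst | hgts := lt_or_ge (g s) (g t)
    · exact .inl ⟨s, le_rfl, hts, hgst⟩
    · exact .inr ⟨k, hkr, hsk, hg.trans_le hgts⟩

theorem StageLe.refl (x : M) : StageLe g x x := .inl rfl

theorem StageLe.trans {x y z : M} (h₁ : StageLe g x y) (h₂ : StageLe g y z) : StageLe g x z := by
  rcases h₁ with rfl | ⟨hxy, h₁⟩ | ⟨hyx, h₁⟩
  · exact h₂
  · rcases h₂ with rfl | ⟨hyz, -⟩ | ⟨-, h₂⟩
    · exact .inr (.inl ⟨hxy, h₁⟩)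
    · exact .inr (.inl ⟨hxy.trans hyz, h₁.mono hyz.le⟩)
    · rcases lt_trichotomy x z with hxz | rfl | hzx
      · exact .inr (.inl ⟨hxz, (h₁.or hxz).resolve_right h₂⟩)
      · exact .refl x
      · exact .inr (.inr ⟨hzx, fun h => h₂ (h.mono hxy.le)⟩)
  · rcases h₂ with rfl | ⟨-, h₂⟩ | ⟨hzy, h₂⟩
    · exact .inr (.inr ⟨hyx, h₁⟩)
    · rcases lt_trichotomy x z with hxz | rfl | hzx
      · exact .inr (.inl ⟨hxz, (h₂.or hyx).resolve_left h₁⟩)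
      · exact .refl x
      · exact absurd (h₂.mono hzx.le) h₁
    · exact .inr (.inr ⟨hzy.trans hyx, fun h => (h.or hzy).elim h₂ h₁⟩)

theorem ValueLe.refl (u : M) : ValueLe g u u := by
  unfold ValueLe
  have : g u ≤ g u := le_rfl
  tauto

theorem ValueLe.trans {u v w : M} (h₁ : ValueLe g u v) (h₂ : ValueLe g v w) : ValueLe g u w := by
  unfold ValueLe at *
  have : g u ≤ g v → g v ≤ g w → g u ≤ g w := le_trans
  tauto

theorem stageValueOrder_le_pair_iff {x u y w : M} :
    (stageValueOrder g).Le (pair x u) (pair y w) ↔ StageLe g x y ∧ ValueLe g u w := by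
  constructor
  · rintro ⟨x', u', y', w', h, hle⟩
    obtain ⟨hxu, hyw⟩ := pair_inj.1 h
    obtain ⟨rfl, rfl⟩ := pair_inj.1 hxu
    obtain ⟨rfl, rfl⟩ := pair_inj.1 hyw
    exact hle
  · exact fun h => ⟨x, u, y, w, rfl, h⟩

/-- A sequence of pairs of stages and values in which no pair is below a later one. -/
def IsBad (g stage value : M → M) : Prop :=
  ∀ i j, i < j → StageLe g (stage i) (stage j) → ¬ ValueLe g (value i) (value j)

theorem IsBad.injective {stage value : M → M} (hbad : IsBad g stage value) :
    Function.Injective fun i => pair (stage i) (value i) := by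
  intro i j h
  obtain ⟨hs, hv⟩ := pair_inj.1 h
  rcases lt_trichotomy i j with hij | rfl | hji
  · exact absurd (hv ▸ .refl _) (hbad i j hij (hs ▸ .refl _))
  · rfl
  · exact absurd (hv ▸ .refl _) (hbad j i hji (hs ▸ .refl _))

end

section

variable {M : Type u} [L2Structure M] [hM : Fact (IsModelRCA0 M)] (g : M → M) [FunDef g]

instance Sigma0.seenFalse {t s : (ℕ → M) → M} [TermDef t] [TermDef s] :
    Sigma0 fun e => SeenFalse g (t e) (s e) := by
  refine Sigma0.comp₂ (P := SeenFalse g) ?_ t s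
  unfold SeenFalse
  infer_instance

instance Sigma0.stageLe {t s : (ℕ → M) → M} [TermDef t] [TermDef s] :
    Sigma0 fun e => StageLe g (t e) (s e) := by
  unfold StageLe
  infer_instance

instance Sigma0.valueLe {t s : (ℕ → M) → M} [TermDef t] [TermDef s] :
    Sigma0 fun e => ValueLe g (t e) (s e) := by
  unfold ValueLe
  infer_instance

variable {g}

theorem prodSet_univ_mem_sets : prodSet Set.univ Set.univ ∈ L2Structure.sets (M := M) := by
  convert setOf_mem_sets fun p : M => ∃ a, a ≤ p ∧ ∃ b, b ≤ p ∧ p = pair a b using 1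
  ext p
  constructor
  · rintro ⟨a, -, b, -, rfl⟩
    exact ⟨a, left_le_pair .., b, right_le_pair .., rfl⟩
  · rintro ⟨a, -, b, -, rfl⟩
    exact ⟨a, trivial, b, trivial, rfl⟩

theorem stageValueOrder_le_mem_sets : (stageValueOrder g).le ∈ L2Structure.sets := by
  convert setOf_mem_sets fun p => ∃ x, x ≤ p ∧ ∃ u, u ≤ p ∧ ∃ y, y ≤ p ∧ ∃ w, w ≤ p ∧
    (p = pair (pair x u) (pair y w) ∧ (StageLe g x y ∧ ValueLe g u w)) using 1
  ext p
  constructor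
  · rintro ⟨x, u, y, w, rfl, h⟩
    exact ⟨x, (left_le_pair ..).trans (left_le_pair ..), u,
      (right_le_pair ..).trans (left_le_pair ..), y, middle_le_pair_pair .., w,
      right_le_pair_pair .., rfl, h⟩
  · rintro ⟨x, -, u, -, y, -, w, -, h⟩
    exact ⟨x, u, y, w, h⟩

theorem stageValueOrder_isQuasiOrder : (stageValueOrder g).IsQuasiOrder where
  carrier_mem := prodSet_univ_mem_sets
  le_mem := stageValueOrder_le_mem_sets
  le_subset := by
    rintro _ ⟨x, u, y, w, rfl, -⟩
    exact ⟨_, ⟨x, trivial, u, trivial, rfl⟩, _, ⟨y, trivial, w, trivial, rfl⟩, rfl⟩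
  refl := by
    rintro _ ⟨x, -, u, -, rfl⟩
    exact stageValueOrder_le_pair_iff.2 ⟨.refl x, .refl u⟩
  trans := by
    rintro _ ⟨x, -, u, -, rfl⟩ _ ⟨y, -, v, -, rfl⟩ _ ⟨z, -, w, -, rfl⟩ h₁ h₂
    rw [stageValueOrder_le_pair_iff] at *
    exact ⟨h₁.1.trans h₂.1, h₁.2.trans h₂.2⟩

/-! ### Bad sequences of stages and values -/

variable {stage value : M → M}

theorem exists_forall_lt_map_lt (f : M → M) [FunDef f] (k : M) : ∃ b, ∀ i < k, f i < b := by
  obtain ⟨b, hb⟩ := collection (fun i y => f i = y) k fun _ _ => ⟨_, rfl⟩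
  refine ⟨b, fun i hi => ?_⟩
  obtain ⟨_, hlt, rfl⟩ := hb i hi
  exact hlt

variable [FunDef stage] [FunDef value]

/-- As the stage `stage j` is taken with a value that is neither `0` nor `1` below a fixed bound
`b`, badness bounds `g (value j)`, hence `value j`. -/
theorem IsBad.exists_forall_value_le (hbad : IsBad g stage value) (hg : Function.Injective g)
    {i₀ k : M} (hk : ∀ j, i₀ < j → stage j < k) : ∃ b, ∀ j, i₀ < j → b ≤ j → value j ≤ b := by
  obtain ⟨b, hb⟩ := strong_bounding
    (fun y i => i₀ < i ∧ (stage i = y ∧ (¬ value i = 0 ∧ ¬ value i = 1))) k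
  obtain ⟨u, hu⟩ := exists_forall_lt_map_lt value b
  obtain ⟨v, hv⟩ := exists_forall_lt_map_lt g u
  obtain ⟨w, hw⟩ := exists_forall_le_of_injective g hg v
  refine ⟨max (max w 1) b, fun j hj hbj => le_max_of_le_left ?_⟩
  by_cases h₁ : value j = 1
  · exact h₁.trans_le (le_max_right ..)
  by_cases h₀ : value j = 0
  · exact h₀.trans_le zero_le
  refine le_max_of_le_left (le_of_not_gt fun hwj => ?_)
  obtain ⟨i, hib, -, hij, hi₀, hi₁⟩ := hb (stage j) (hk j hj) ⟨j, hj, rfl, h₀, h₁⟩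
  have hle : g (value i) ≤ g (value j) := (hv _ (hu i hib)).le.trans (hw _ hwj.le)
  exact hbad i j (hib.trans_le ((le_max_right ..).trans hbj)) (hij ▸ .refl _)
    (.inr ⟨hi₁, .inr ⟨hi₀, hle⟩⟩)

theorem IsBad.exists_le_stage (hbad : IsBad g stage value) (hg : Function.Injective g) (i₀ k : M) :
    ∃ j, i₀ < j ∧ k ≤ stage j := by
  by_contra! hk
  obtain ⟨b, hb⟩ := hbad.exists_forall_value_le hg hk
  obtain ⟨c, hc⟩ := exists_forall_le_of_injective _ hbad.injective (pair k b + 1)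
  have hj : i₀ < max (max (i₀ + 1) b) c :=
    (lt_add_one i₀).trans_le ((le_max_left ..).trans (le_max_left ..))
  have hbj := hb _ hj ((le_max_right ..).trans (le_max_left ..))
  exact ((Order.add_one_le_iff.1 (hc _ (le_max_right ..))).trans_le
    (pair_le_pair (hk _ hj).le hbj)).false

theorem exists_minimal_value (P : M → Prop) [hP : Sigma1 fun e => P (e 0)] (h : ∃ i, P i) :
    ∃ i, P i ∧ ∀ j, P j → ValueLe g (value i) (value j) := by
  have := hP.comp
  by_cases hproper : ∃ i, P i ∧ value i ≠ 0 ∧ value i ≠ 1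
  · obtain ⟨_, ⟨i, hi, h₀, h₁, _, rfl, rfl⟩, hmin⟩ := exists_least
      (fun n => ∃ i, P i ∧ ¬ value i = 0 ∧ ¬ value i = 1 ∧ ∃ u, value i = u ∧ g u = n)
      (hproper.elim fun i ⟨hi, h₀, h₁⟩ => ⟨_, i, hi, h₀, h₁, _, rfl, rfl⟩)
    refine ⟨i, hi, fun j hj => ?_⟩
    by_cases hj₁ : value j = 1
    · exact .inl hj₁
    by_cases hj₀ : value j = 0
    · exact .inr ⟨h₁, .inl hj₀⟩
    · exact .inr ⟨h₁, .inr ⟨h₀, le_of_not_gt fun hlt => hmin _ hlt ⟨j, hj, hj₀, hj₁, _, rfl, rfl⟩⟩⟩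
  push Not at hproper
  by_cases hzero : ∃ i, P i ∧ value i = 0
  · obtain ⟨i, hi, h₀⟩ := hzero
    refine ⟨i, hi, fun j hj => ?_⟩
    by_cases hj₀ : value j = 0
    · exact .inr ⟨by simp [h₀], .inl hj₀⟩
    · exact .inl (hproper j hj hj₀)
  · push Not at hzero
    exact h.imp fun i hi => ⟨hi, fun j hj => .inl (hproper j hj (hzero j hj))⟩

/-- After a false stage of least value has been seen to be false, badness excludes false stages. -/
theorem IsBad.exists_forall_true (hbad : IsBad g stage value) :
    ∃ i₀ k₀, ∀ j, i₀ < j → k₀ ≤ stage j → ∀ k, stage j < k → g (stage j) ≤ g k := by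
  by_cases hfalse : ∃ i, ∃ x, stage i = x ∧ ∃ k, x < k ∧ g k < g x
  · obtain ⟨i, ⟨_, rfl, k, hik, hgk⟩, hmin⟩ :=
      exists_minimal_value (g := g) (value := value) _ hfalse
    refine ⟨i, k, fun j hij hkj l hl => le_of_not_gt fun hgl => ?_⟩
    exact hbad i j hij (.inr (.inl ⟨hik.trans_le hkj, k, hkj, hik, hgk⟩))
      (hmin j ⟨_, rfl, l, hl, hgl⟩)
  · push Not at hfalse
    exact ⟨0, 0, fun j _ _ k => hfalse j _ rfl k⟩

/-- A number `n` is not in the range of `g` if it is not enumerated up to some true stage whose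
value exceeds `n`. -/
theorem IsBad.range_mem_sets (hbad : IsBad g stage value) (hg : Function.Injective g) :
    {n | ∃ x, g x = n} ∈ L2Structure.sets := by
  obtain ⟨i₀, k₀, htrue⟩ := hbad.exists_forall_true
  have not_range_iff (n : M) : (¬ ∃ x, g x = n) ↔
      ∃ j x v, i₀ < j ∧ stage j = x ∧ k₀ ≤ x ∧ g x = v ∧ n < v ∧ ∀ y, y ≤ x → ¬ g y = n := by
    constructor
    · intro hn
      obtain ⟨b, hb⟩ := exists_forall_le_of_injective g hg (n + 1)
      obtain ⟨j, hj, hbj⟩ := hbad.exists_le_stage hg i₀ (max k₀ b)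
      exact ⟨j, _, _, hj, rfl, (le_max_left ..).trans hbj, rfl,
        Order.add_one_le_iff.1 (hb _ ((le_max_right ..).trans hbj)), fun y _ hy => hn ⟨y, hy⟩⟩
    · rintro ⟨j, _, _, hj, rfl, hk, rfl, hn, hy⟩ ⟨y, rfl⟩
      exact (htrue j hj hk y (not_le.1 fun h => hy y h rfl)).not_gt hn
  have : Sigma1 fun e : ℕ → M => ¬ ∃ x, g x = e 0 := by
    simp only [not_range_iff]
    infer_instance
  exact delta1_comprehension fun n => ∃ x, g x = n

end

section

variable {M : Type u} [L2Structure M] [hM : Fact (IsModelRCA0 M)] {g : M → M} [FunDef g]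

theorem exists_components {F : Set M} (hF : IsFunction F Set.univ (prodSet Set.univ Set.univ)) :
    ∃ f h : M → M, FunDef f ∧ FunDef h ∧ ∀ i, pair i (pair (f i) (h i)) ∈ F := by
  have := Fact.mk hF.1
  have hex (i : M) : ∃ x u, pair i (pair x u) ∈ F := by
    obtain ⟨b, hb, -⟩ := hF.2.2 i trivial
    obtain ⟨_, -, _, ⟨x, -, u, -, rfl⟩, h⟩ := hF.2.1 hb
    exact ⟨x, u, (pair_inj.1 h).2 ▸ hb⟩
  choose f h hfh using hex
  have mem_iff (i x u : M) : pair i (pair x u) ∈ F ↔ f i = x ∧ h i = u := by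
    refine ⟨fun hi => pair_inj.1 ((hF.2.2 i trivial).unique (hfh i) hi), ?_⟩
    rintro ⟨rfl, rfl⟩
    exact hfh i
  refine ⟨f, h, ⟨?_⟩, ⟨?_⟩, hfh⟩
  · refine .of_delta1 (P := fun i x => f i = x)
      (.congr (P := fun e => ∃ u, pair (e 0) (pair (e 1) u) ∈ F) inferInstance ?_)
      (.congr (P := fun e => ∃ x u, ¬ x = e 1 ∧ pair (e 0) (pair x u) ∈ F) inferInstance ?_)
    all_goals simp [mem_iff]
  · refine .of_delta1 (P := fun i u => h i = u)
      (.congr (P := fun e => ∃ x, pair (e 0) (pair x (e 1)) ∈ F) inferInstance ?_)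
      (.congr (P := fun e => ∃ x u, ¬ u = e 1 ∧ pair (e 0) (pair x u) ∈ F) inferInstance ?_)
    all_goals simp [mem_iff]

theorem stageValueOrder_isWqo (hg : Function.Injective g)
    (hrange : {n | ∃ x, g x = n} ∉ L2Structure.sets) : (stageValueOrder g).IsWqo := by
  refine ⟨stageValueOrder_isQuasiOrder, fun F hF => ?_⟩
  by_contra! hbad
  obtain ⟨stage, value, _, _, hmem⟩ := exists_components hF
  have hbad' : ¬ IsBad g stage value := fun h => hrange (h.range_mem_sets hg)
  refine hbad' fun i j hij hs hv => ?_
  exact hbad i j _ _ hij (hmem i) (hmem j) (stageValueOrder_le_pair_iff.2 ⟨hs, hv⟩)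

end

/-! ### Sequences of closed sets -/

theorem not_upper_basic_iff {M : Type u} [L2Structure M] {Q : CodedRel M} {x i : M}
    (hx : x ∈ Q.carrier) :
    ¬ Q.upper.basic x i ↔ ∃ p, FinMem p i ∧ Q.Le x p := by
  simp only [CodedRel.upper, hx, true_and, not_not]

section

variable {M : Type u} [L2Structure M] [hM : Fact (DiscretelyOrderedSemiring M)]

theorem finFlat_le_iff {Q : CodedRel M} {a b : M} (ha : a ∈ finSubsets Q.carrier)
    (hb : b ∈ finSubsets Q.carrier) :
    Q.finFlat.Le a b ↔ ∀ i, FinMem i a → ∃ j, FinMem j b ∧ Q.Le i j := by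
  constructor
  · rintro ⟨a', -, b', -, hab, h⟩
    obtain ⟨rfl, rfl⟩ := pair_inj.1 hab
    exact h
  · exact fun h => ⟨a, ha, b, hb, rfl, h⟩

end

section

variable {M : Type u} [L2Structure M] [hM : Fact (IsModelRCA0 M)]

theorem exists_codes_pair (a b : M) : ∃ c, Codes c {a, b} :=
  exists_codes (fun i => i = a ∨ i = b) (max a b + 1) <| by
    rintro i (rfl | rfl)
    exacts [Order.lt_add_one_iff.2 (le_max_left ..), Order.lt_add_one_iff.2 (le_max_right ..)]

/-- The code of the set `{a, b}`. -/
noncomputable def pairCode (a b : M) : M := (exists_codes_pair a b).choose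

theorem codes_pairCode (a b : M) : Codes (pairCode a b) {a, b} :=
  (exists_codes_pair a b).choose_spec

theorem finMem_pairCode_iff {a b i : M} : FinMem i (pairCode a b) ↔ i = a ∨ i = b :=
  (codes_pairCode a b).2 i

theorem pairCode_mem_finSubsets {a b : M} {A : Set M} (ha : a ∈ A) (hb : b ∈ A) :
    pairCode a b ∈ finSubsets A := by
  refine ⟨(codes_pairCode a b).1, fun i hi => ?_⟩
  obtain rfl | rfl := finMem_pairCode_iff.1 hi
  exacts [ha, hb]

theorem eq_pairCode_iff {a b c : M} : c = pairCode a b ↔ IsFinCode c ∧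
    FinMem a c ∧ FinMem b c ∧ ∀ i, i < c → FinMem i c → i = a ∨ i = b := by
  constructor
  · rintro rfl
    exact ⟨(codes_pairCode a b).1, finMem_pairCode_iff.2 (.inl rfl),
      finMem_pairCode_iff.2 (.inr rfl), fun i _ => finMem_pairCode_iff.1⟩
  · rintro ⟨hc, ha, hb, h⟩
    refine Codes.unique ⟨hc, fun i => ⟨fun hi => h i hi.lt hi, ?_⟩⟩ (codes_pairCode a b)
    rintro (rfl | rfl)
    exacts [ha, hb]

instance Sigma0.eq_pairCode {c a b : (ℕ → M) → M} [TermDef c] [TermDef a] [TermDef b] :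
    Sigma0 fun e => c e = pairCode (a e) (b e) := by
  refine Sigma0.comp₃ (P := fun c a b => c = pairCode a b) ?_ c a b
  simp only [eq_pairCode_iff]
  infer_instance

/-- The graph of the function `(n, m) ↦ {f (min m n)}`, which codes the sequence of the
intersections of the complements of the basic open sets with indices `f 0, …, f n`. -/
def closedSequence (f : M → M) : Set M :=
  {p | ∃ n m, p = pair (pair n m) (pairCode (f (min m n)) (f (min m n)))}

theorem closedSequence_mem_sets (f : M → M) [FunDef f] : closedSequence f ∈ L2Structure.sets := by
  convert setOf_mem_sets fun p => ∃ n, n ≤ p ∧ ∃ m, m ≤ p ∧ ∃ c, c ≤ p ∧ p = pair (pair n m) c ∧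
    ∃ d, d < c ∧ c = pairCode d d ∧ (m ≤ n ∧ f m = d ∨ n < m ∧ f n = d) using 1
  ext p
  constructor
  · rintro ⟨n, m, rfl⟩
    refine ⟨n, (left_le_pair ..).trans (left_le_pair ..), m,
      (right_le_pair ..).trans (left_le_pair ..), _, right_le_pair .., rfl, f (min m n),
      (finMem_pairCode_iff.2 (.inl rfl)).lt, rfl, ?_⟩
    obtain h | h := le_or_gt m n
    · exact .inl ⟨h, by rw [min_eq_left h]⟩
    · exact .inr ⟨h, by rw [min_eq_right h.le]⟩
  · rintro ⟨n, -, m, -, _, -, rfl, d, -, rfl, ⟨h, rfl⟩ | ⟨h, rfl⟩⟩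
    · exact ⟨n, m, by rw [min_eq_left h]⟩
    · exact ⟨n, m, by rw [min_eq_right h.le]⟩

theorem closedSequence_isFunction {f : M → M} [FunDef f] {A : Set M} (hf : ∀ n, f n ∈ A) :
    IsFunction (closedSequence f) (prodSet Set.univ Set.univ) (finSubsets A) := by
  refine ⟨closedSequence_mem_sets f, ?_, ?_⟩
  · rintro _ ⟨n, m, rfl⟩
    exact ⟨_, ⟨n, trivial, m, trivial, rfl⟩, _, pairCode_mem_finSubsets (hf _) (hf _), rfl⟩
  · rintro _ ⟨n, -, m, -, rfl⟩
    refine ⟨_, ⟨n, m, rfl⟩, ?_⟩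
    rintro c ⟨n', m', h⟩
    obtain ⟨hnm, rfl⟩ := pair_inj.1 h
    obtain ⟨rfl, rfl⟩ := pair_inj.1 hnm
    rfl

theorem mem_closedTerm_closedSequence_iff {X : CodedSpace M} {f : M → M} {n x : M} :
    x ∈ X.closedTerm (closedSequence f) n ↔
      x ∈ X.points ∧ ∀ m ≤ n, ¬ X.basic x (f m) := by
  refine and_congr_right fun _ => ⟨fun h m hm => ?_, fun h => ?_⟩
  · refine h m _ _ ⟨n, m, rfl⟩ ?_
    rw [min_eq_left hm, finMem_pairCode_iff, or_self]
  · rintro m c i ⟨n', m', hc⟩ hi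
    obtain ⟨hnm, rfl⟩ := pair_inj.1 hc
    obtain ⟨rfl, rfl⟩ := pair_inj.1 hnm
    rw [finMem_pairCode_iff, or_self] at hi
    exact hi ▸ h _ (min_le_right ..)

theorem CodedSpace.IsNoetherian.exists_forall_not_basic {X : CodedSpace M} (hX : X.IsNoetherian)
    (f : M → M) [FunDef f] (hf : ∀ n, f n ∈ X.index) :
    ∃ N, ∀ x ∈ X.points, (∀ m ≤ N, ¬ X.basic x (f m)) → ∀ m, ¬ X.basic x (f m) := by
  obtain ⟨N, hN⟩ := hX (closedSequence f) (closedSequence_isFunction hf) fun n x hx => by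
    rw [mem_closedTerm_closedSequence_iff] at hx ⊢
    exact ⟨hx.1, fun m hm => hx.2 m (hm.trans le_self_add)⟩
  refine ⟨N, fun x hx h m => ?_⟩
  obtain hm | hm := le_or_gt m N
  · exact h m hm
  · have : x ∈ X.closedTerm (closedSequence f) m :=
      hN m hm ▸ mem_closedTerm_closedSequence_iff.2 ⟨hx, h⟩
    exact (mem_closedTerm_closedSequence_iff.1 this).2 m le_rfl

end

/-! ### Parity -/

section

variable {M : Type u} [L2Structure M] [hM : Fact (DiscretelyOrderedSemiring M)] {a b : M}

theorem two_mul_lt_two_mul : 2 * a < 2 * b ↔ a < b := mul_lt_mul_iff_right₀ two_pos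

theorem two_mul_inj : 2 * a = 2 * b ↔ a = b := mul_right_inj' two_ne_zero

theorem two_mul_add_one_lt_two_mul : 2 * a + 1 < 2 * b ↔ a < b := by
  refine ⟨fun h => two_mul_lt_two_mul.1 ((lt_add_one _).trans h), fun h => ?_⟩
  calc 2 * a + 1 < 2 * a + 1 + 1 := lt_add_one _
    _ = 2 * (a + 1) := by ring
    _ ≤ 2 * b := mul_le_mul_right (Order.add_one_le_iff.2 h) 2

theorem two_mul_add_one_ne_two_mul (a b : M) : 2 * a + 1 ≠ 2 * b := by
  intro h
  obtain hab | hba := lt_or_ge a b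
  · exact (two_mul_add_one_lt_two_mul.2 hab).ne h
  · exact (h ▸ lt_add_one (2 * a)).not_ge (mul_le_mul_right hba 2)

end

section

variable {M : Type u} [L2Structure M] [hM : Fact (IsModelRCA0 M)]

theorem exists_eq_two_mul_or_eq_two_mul_add_one (x : M) : ∃ r, x = 2 * r ∨ x = 2 * r + 1 := by
  refine sigma1_induction (fun x => ∃ r, x = 2 * r ∨ x = 2 * r + 1) ⟨0, .inl (mul_zero 2).symm⟩ ?_ x
  rintro _ ⟨r, rfl | rfl⟩
  exacts [⟨r, .inr rfl⟩, ⟨r + 1, .inl (by ring)⟩]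

end

/-! ### A strictly descending sequence of closed sets -/

/-- An injection that fixes `0` and sends every odd number to the successor of the value at its
predecessor, so that the elements at the places `2 * r` and `2 * r + 1` are neighbours in the order
of the values. -/
structure IsPaired {M : Type u} [L2Structure M] [Fact (DiscretelyOrderedSemiring M)] (g : M → M) :
    Prop where
  injective : Function.Injective g
  map_zero : g 0 = 0
  map_two_mul_add_one (r : M) : g (2 * r + 1) = g (2 * r) + 1

section

variable {M : Type u} [L2Structure M] [hM : Fact (IsModelRCA0 M)] (g : M → M)

/-- The stage `s` is paired with the next stage `r` that has the least value at an even place among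
those up to `n`, or with `0` if `s = n`. -/
def NextStage (n s r : M) : Prop :=
  s = n ∧ r = 0 ∨ s < r ∧ r ≤ n ∧ ∀ k, k ≤ n → s < k → ¬ g (2 * k) < g (2 * r)

instance Sigma0.nextStage [FunDef g] {n s r : (ℕ → M) → M} [TermDef n] [TermDef s] [TermDef r] :
    Sigma0 fun e => NextStage g (n e) (s e) (r e) := by
  refine Sigma0.comp₃ (P := NextStage g) ?_ n s r
  unfold NextStage
  infer_instance

/-- A finite set that generates the complement of the up-closure of `pair (2 * s) (2 * r + 1)` in
`stageValueOrder g`, for `g` as in `IsPaired`: its elements combine the predecessor of one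
component with the top element for the other one. -/
noncomputable def complement (s r : M) : M := pairCode (pair (2 * s + 1) 1) (pair 0 (2 * r))

instance Sigma0.eq_complement {z s r : (ℕ → M) → M} [TermDef z] [TermDef s] [TermDef r] :
    Sigma0 fun e => z e = complement (s e) (r e) := by
  unfold complement
  infer_instance

variable {g}

theorem finMem_complement_iff {s r p : M} :
    FinMem p (complement s r) ↔ p = pair (2 * s + 1) 1 ∨ p = pair 0 (2 * r) :=
  finMem_pairCode_iff

theorem complement_mem_finSubsets (s r : M) :
    complement s r ∈ finSubsets (stageValueOrder g).carrier :=
  pairCode_mem_finSubsets ⟨_, trivial, _, trivial, rfl⟩ ⟨_, trivial, _, trivial, rfl⟩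

theorem NextStage.left_le {n s r : M} (h : NextStage g n s r) : s ≤ n := by
  obtain ⟨rfl, -⟩ | ⟨hsr, hrn, -⟩ := h
  exacts [le_rfl, hsr.le.trans hrn]

theorem NextStage.right_le {n s r : M} (h : NextStage g n s r) : r ≤ n := by
  obtain ⟨-, rfl⟩ | ⟨-, hrn, -⟩ := h
  exacts [zero_le, hrn]

variable [FunDef g]

theorem exists_complement_lt (n : M) : ∃ b : M, ∀ s ≤ n, ∀ r ≤ n, complement s r < b := by
  obtain ⟨b, hb⟩ := strong_bounding
    (fun y z : M => ∃ s, s ≤ y ∧ ∃ r, r ≤ y ∧ y = pair s r ∧ z = complement s r) (pair n n + 1)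
  refine ⟨b, fun s hs r hr => ?_⟩
  obtain ⟨_, hlt, s', -, r', -, hsr, rfl⟩ := hb (pair s r)
    (Order.lt_add_one_iff.2 (pair_le_pair hs hr))
    ⟨_, s, left_le_pair .., r, right_le_pair .., rfl, rfl⟩
  obtain ⟨rfl, rfl⟩ := pair_inj.1 hsr
  exact hlt

theorem exists_codes_complements (n : M) :
    ∃ c, Codes c {z | ∃ s r, NextStage g n s r ∧ z = complement s r} := by
  obtain ⟨b, hb⟩ := exists_complement_lt n
  obtain ⟨c, hc, hc'⟩ := exists_codes
    (fun z => ∃ s, s ≤ n ∧ ∃ r, r ≤ n ∧ NextStage g n s r ∧ z = complement s r) b (by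
      rintro _ ⟨s, hs, r, hr, -, rfl⟩
      exact hb s hs r hr)
  exact ⟨c, hc, fun z => (hc' z).trans ⟨fun ⟨s, _, r, _, h⟩ => ⟨s, r, h⟩,
    fun ⟨s, r, h, hz⟩ => ⟨s, h.left_le, r, h.right_le, h, hz⟩⟩⟩

variable (g) in
/-- The code of the set of the complements for all pairs in `NextStage g n`. -/
noncomputable def complementsCode (n : M) : M := (exists_codes_complements (g := g) n).choose

theorem codes_complementsCode (n : M) :
    Codes (complementsCode g n) {z | ∃ s r, NextStage g n s r ∧ z = complement s r} :=
  (exists_codes_complements n).choose_spec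

theorem complementsCode_mem_index (n : M) :
    complementsCode g n ∈ (stageValueOrder g).finFlat.upper.index := by
  refine ⟨(codes_complementsCode n).1, fun z hz => ?_⟩
  obtain ⟨s, r, -, rfl⟩ := ((codes_complementsCode n).2 z).1 hz
  exact complement_mem_finSubsets s r

instance FunDef.complementsCode : FunDef (complementsCode g) := by
  refine ⟨.congr (P := fun e => IsFinCode (e 1) ∧
    (∀ z, z < e 1 → FinMem z (e 1) →
      ∃ s, s ≤ e 0 ∧ ∃ r, r ≤ e 0 ∧ NextStage g (e 0) s r ∧ z = complement s r) ∧
    ∀ s, s ≤ e 0 → ∀ r, r ≤ e 0 → NextStage g (e 0) s r →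
      ∃ z, z < e 1 ∧ FinMem z (e 1) ∧ z = complement s r) inferInstance fun e => ⟨fun h => ?_, ?_⟩⟩
  · obtain ⟨hc, hmem⟩ := h ▸ codes_complementsCode (g := g) (e 0)
    refine ⟨hc, fun z _ hz => ?_, fun s _ r _ hsr => ?_⟩
    · obtain ⟨s, r, hsr, hz⟩ := (hmem z).1 hz
      exact ⟨s, hsr.left_le, r, hsr.right_le, hsr, hz⟩
    · have hz := (hmem (complement s r)).2 ⟨s, r, hsr, rfl⟩
      exact ⟨_, hz.lt, hz, rfl⟩
  · rintro ⟨hc, h, h'⟩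
    refine (codes_complementsCode (e 0)).unique ⟨hc, fun z => ⟨fun hz => ?_, ?_⟩⟩
    · obtain ⟨s, -, r, -, hsr⟩ := h z hz.lt hz
      exact ⟨s, r, hsr⟩
    · rintro ⟨s, r, hsr, rfl⟩
      obtain ⟨_, -, hz, rfl⟩ := h' s hsr.left_le r hsr.right_le hsr
      exact hz

theorem not_basic_complementsCode_iff {x n : M} (hx : x ∈ finSubsets (stageValueOrder g).carrier) :
    ¬ (stageValueOrder g).finFlat.upper.basic x (complementsCode g n) ↔
      ∃ s r, NextStage g n s r ∧ ∀ p, FinMem p x →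
        (stageValueOrder g).Le p (pair (2 * s + 1) 1) ∨
          (stageValueOrder g).Le p (pair 0 (2 * r)) := by
  have le_complement_iff (s r : M) : (stageValueOrder g).finFlat.Le x (complement s r) ↔
      ∀ p, FinMem p x → (stageValueOrder g).Le p (pair (2 * s + 1) 1) ∨
        (stageValueOrder g).Le p (pair 0 (2 * r)) := by
    simp only [finFlat_le_iff hx (complement_mem_finSubsets s r), finMem_complement_iff,
      or_and_right, exists_or, exists_eq_left]
  rw [not_upper_basic_iff hx]
  constructor
  · rintro ⟨z, hz, hxz⟩
    obtain ⟨s, r, hsr, rfl⟩ := ((codes_complementsCode n).2 z).1 hz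
    exact ⟨s, r, hsr, (le_complement_iff s r).1 hxz⟩
  · rintro ⟨s, r, hsr, h⟩
    exact ⟨_, ((codes_complementsCode n).2 _).2 ⟨s, r, hsr, rfl⟩, (le_complement_iff s r).2 h⟩

end

section

variable {M : Type u} [L2Structure M] [hM : Fact (DiscretelyOrderedSemiring M)] {g : M → M}

theorem IsPaired.map_pos (hg : IsPaired g) {k : M} (hk : 0 < k) : 0 < g k := by
  rw [pos_iff_ne_zero, ← hg.map_zero]
  exact hg.injective.ne hk.ne'

theorem IsPaired.map_two_mul_inj (hg : IsPaired g) {s k : M} : g (2 * s) = g (2 * k) ↔ s = k :=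
  hg.injective.eq_iff.trans two_mul_inj

theorem IsPaired.stageLe_zero (hg : IsPaired g) (x : M) : StageLe g x 0 := by
  obtain rfl | hx := eq_or_ne x 0
  · exact .refl _
  · refine .inr (.inr ⟨pos_iff_ne_zero.2 hx, fun ⟨k, _, _, hk⟩ => ?_⟩)
    exact not_lt_zero (hg.map_zero ▸ hk)

theorem IsPaired.not_stageLe_two_mul_add_one (hg : IsPaired g) (s : M) :
    ¬ StageLe g (2 * s) (2 * s + 1) := by
  rintro (h | ⟨-, k, hk, hsk, hgk⟩ | ⟨h, -⟩)
  · exact (lt_add_one _).ne h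
  · rw [le_antisymm hk (Order.add_one_le_iff.2 hsk), hg.map_two_mul_add_one] at hgk
    exact hgk.not_gt (lt_add_one _)
  · exact h.not_gt (lt_add_one _)

theorem IsPaired.not_valueLe_two_mul_add_one (hg : IsPaired g) (r : M) :
    ¬ ValueLe g (2 * r + 1) (2 * r) := by
  rintro (h | ⟨h₁, h₀ | ⟨-, h⟩⟩)
  · exact two_mul_add_one_ne_two_mul 0 r (by simp [h])
  · exact h₁ (by simp [h₀])
  · exact (hg.map_two_mul_add_one r ▸ h).not_gt (lt_add_one _)

theorem two_mul_add_one_ne_one {r : M} (hr : 0 < r) : 2 * r + 1 ≠ 1 := by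
  simp [hr.ne']

theorem IsPaired.valueLe_two_mul_add_one (hg : IsPaired g) {r t : M} (hr : 0 < r)
    (h : g (2 * r) < g (2 * t)) : ValueLe g (2 * r + 1) (2 * t) := by
  refine .inr ⟨two_mul_add_one_ne_one hr, .inr ⟨(add_one_pos _).ne', ?_⟩⟩
  rw [hg.map_two_mul_add_one]
  exact Order.add_one_le_iff.2 h

end

section

variable {M : Type u} [L2Structure M] [hM : Fact (IsModelRCA0 M)] {g : M → M}

theorem IsPaired.stageLe_two_mul_two_mul_add_one (hg : IsPaired g) {s t : M} (hst : s < t)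
    (h : ∀ k, s < k → k ≤ t → g (2 * s) < g (2 * k)) : StageLe g (2 * t) (2 * s + 1) := by
  refine .inr (.inr ⟨two_mul_add_one_lt_two_mul.2 hst, fun ⟨k, hkt, hsk, hgk⟩ => ?_⟩)
  rw [hg.map_two_mul_add_one, Order.lt_add_one_iff] at hgk
  obtain ⟨j, rfl | rfl⟩ := exists_eq_two_mul_or_eq_two_mul_add_one k
  · exact (h j (two_mul_add_one_lt_two_mul.1 hsk) (le_of_mul_le_mul_left hkt two_pos)).not_ge hgk
  · have hjt := two_mul_add_one_lt_two_mul.1 (hkt.lt_of_ne (two_mul_add_one_ne_two_mul j t))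
    have hlt := h j (two_mul_lt_two_mul.1 (lt_of_add_lt_add_right hsk)) hjt.le
    rw [hg.map_two_mul_add_one] at hgk
    exact (hlt.trans (lt_add_one _)).not_ge hgk

variable [FunDef g]

theorem exists_nextStage_code (n : M) :
    ∃ x, Codes x {p | ∃ s r, NextStage g n s r ∧ p = pair (2 * s) (2 * r + 1)} := by
  obtain ⟨x, hx, hx'⟩ := exists_codes
    (fun p => ∃ s, s ≤ n ∧ ∃ r, r ≤ n ∧ NextStage g n s r ∧ p = pair (2 * s) (2 * r + 1))
    (pair (2 * n) (2 * n + 1) + 1) (by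
      rintro _ ⟨s, hs, r, hr, -, rfl⟩
      exact Order.lt_add_one_iff.2 (pair_le_pair (by gcongr) (by gcongr)))
  exact ⟨x, hx, fun p => (hx' p).trans ⟨fun ⟨s, _, r, _, h⟩ => ⟨s, r, h⟩,
    fun ⟨s, r, h, hp⟩ => ⟨s, h.left_le, r, h.right_le, h, hp⟩⟩⟩

variable (g) in
theorem exists_argmin {a b : M} (hab : a < b) :
    ∃ k, a < k ∧ k ≤ b ∧ ∀ j, a < j → j ≤ b → g (2 * k) ≤ g (2 * j) := by
  obtain ⟨_, ⟨k, hk, hak, rfl⟩, hmin⟩ := exists_least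
    (fun v => ∃ k, k ≤ b ∧ (a < k ∧ g (2 * k) = v)) ⟨_, b, le_rfl, hab, rfl⟩
  exact ⟨k, hak, hk, fun j hj hj' => le_of_not_gt fun h => hmin _ h ⟨j, hj', hj, rfl⟩⟩

/-- The last stage `s` up to `n` with `g (2 * s) < g (2 * k)` works: the elements of later stages
are in the complement by their stages, those of earlier ones by their values. -/
theorem IsPaired.exists_nextStage_of_map_lt (hg : IsPaired g) {n m k : M} (hnk : n < k)
    (hkm : k ≤ m) (hmin : ∀ j, n < j → j ≤ m → g (2 * k) ≤ g (2 * j))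
    (hgk : g (2 * k) < g (2 * n)) :
    ∃ s r, NextStage g n s r ∧ ∀ s' r', NextStage g m s' r' →
      StageLe g (2 * s') (2 * s + 1) ∨ ValueLe g (2 * r' + 1) (2 * r) := by
  have hpos : g (2 * 0) < g (2 * k) := by
    simpa [hg.map_zero] using hg.map_pos (mul_pos two_pos (zero_le.trans_lt hnk))
  obtain ⟨s, hsn, hsk, hs⟩ := exists_greatest (fun s => g (2 * s) < g (2 * k)) n ⟨0, zero_le, hpos⟩
  have hsn : s < n := hsn.lt_of_ne fun h => hsk.not_gt (h ▸ hgk)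
  obtain ⟨r, hsr, hrn, hr⟩ := exists_argmin g hsn
  have hkr : g (2 * k) < g (2 * r) :=
    (le_of_not_gt fun h => (hs r hrn h).not_gt hsr).lt_of_ne fun h =>
      (hrn.trans_lt hnk).ne' (hg.map_two_mul_inj.1 h)
  refine ⟨s, r, .inr ⟨hsr, hrn, fun j hj hj' => (hr j hj' hj).not_gt⟩, fun s' r' h' => ?_⟩
  obtain hss | hss := lt_or_ge s s'
  · refine .inl (hg.stageLe_two_mul_two_mul_add_one hss fun j hj hj' => hsk.trans_le ?_)
    obtain hjn | hnj := le_or_gt j n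
    · exact hkr.le.trans (hr j hj hjn)
    · exact hmin j hnj (hj'.trans h'.left_le)
  · obtain ⟨rfl, -⟩ | ⟨hsr', -, hr'⟩ := h'
    · exact absurd (hnk.trans_le hkm) (hss.trans hsn.le).not_gt
    · refine .inr (hg.valueLe_two_mul_add_one (zero_le.trans_lt hsr') (lt_of_le_of_lt ?_ hkr))
      exact le_of_not_gt (hr' k hkm ((hss.trans_lt hsn).trans hnk))

theorem IsPaired.exists_nextStage (hg : IsPaired g) {n m : M} (hnm : n < m) :
    ∃ s r, NextStage g n s r ∧ ∀ s' r', NextStage g m s' r' →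
      StageLe g (2 * s') (2 * s + 1) ∨ ValueLe g (2 * r' + 1) (2 * r) := by
  obtain ⟨k, hnk, hkm, hmin⟩ := exists_argmin g hnm
  obtain hgk | hgk := lt_or_ge (g (2 * k)) (g (2 * n))
  · exact hg.exists_nextStage_of_map_lt hnk hkm hmin hgk
  have hgn : g (2 * n) < g (2 * k) := hgk.lt_of_ne fun h => hnk.ne (hg.map_two_mul_inj.1 h)
  refine ⟨n, 0, .inl ⟨rfl, rfl⟩, fun s' r' h' => ?_⟩
  obtain hns | hsn := lt_or_ge n s'
  · exact .inl (hg.stageLe_two_mul_two_mul_add_one hns fun j hj hj' =>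
      hgn.trans_le (hmin j hj (hj'.trans h'.left_le)))
  · obtain ⟨rfl, -⟩ | ⟨hsr, -⟩ := h'
    · exact absurd hnm hsn.not_gt
    · exact .inr (.inr ⟨two_mul_add_one_ne_one (zero_le.trans_lt hsr), .inl (mul_zero 2)⟩)

/-- The code of the pairs in `NextStage g n` avoids the open sets given by `complementsCode g`
before `n`, but not the one at `n`. -/
theorem IsPaired.not_isNoetherian (hg : IsPaired g) :
    ¬ (stageValueOrder g).finFlat.upper.IsNoetherian := by
  intro hX
  obtain ⟨N, hN⟩ := hX.exists_forall_not_basic (complementsCode g) complementsCode_mem_index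
  obtain ⟨x, hx, hmem⟩ := exists_nextStage_code (g := g) (N + 1)
  have hxQ : x ∈ finSubsets (stageValueOrder g).carrier := by
    refine ⟨hx, fun p hp => ?_⟩
    obtain ⟨s, r, -, rfl⟩ := (hmem p).1 hp
    exact ⟨_, trivial, _, trivial, rfl⟩
  have hxN (m : M) (hm : m ≤ N) :
      ¬ (stageValueOrder g).finFlat.upper.basic x (complementsCode g m) := by
    obtain ⟨s, r, hsr, h⟩ := hg.exists_nextStage (Order.lt_add_one_iff.2 hm)
    refine (not_basic_complementsCode_iff hxQ).2 ⟨s, r, hsr, fun p hp => ?_⟩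
    obtain ⟨s', r', hsr', rfl⟩ := (hmem p).1 hp
    simp only [stageValueOrder_le_pair_iff]
    exact (h s' r' hsr').imp (⟨·, .inl rfl⟩) (⟨hg.stageLe_zero _, ·⟩)
  obtain ⟨s, r, hsr, h⟩ := (not_basic_complementsCode_iff hxQ).1 (hN x hxQ hxN (N + 1))
  have hp := h _ ((hmem _).2 ⟨s, r, hsr, rfl⟩)
  simp only [stageValueOrder_le_pair_iff] at hp
  exact hp.elim (fun h => hg.not_stageLe_two_mul_add_one s h.1)
    fun h => hg.not_valueLe_two_mul_add_one r h.2

end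

/-! ### Paired enumerations -/

section

variable {M : Type u} [L2Structure M] [hM : Fact (IsModelRCA0 M)]

theorem FunDef.of_map_two_mul {g h : M → M} [FunDef h] (map_even : ∀ r, g (2 * r) = 2 * h r)
    (map_odd : ∀ r, g (2 * r + 1) = 2 * h r + 1) : FunDef g := by
  have le_two_mul (a : M) : a ≤ 2 * a := le_mul_of_one_le_left' one_le_two
  refine ⟨.congr (P := fun e => ∃ r, r ≤ e 0 ∧ ∃ v, v ≤ e 1 ∧ (h r = v ∧
    (e 0 = 2 * r ∧ e 1 = 2 * v ∨ e 0 = 2 * r + 1 ∧ e 1 = 2 * v + 1))) inferInstance fun e => ?_⟩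
  constructor
  · intro he
    obtain ⟨r, hr | hr⟩ := exists_eq_two_mul_or_eq_two_mul_add_one (e 0) <;> rw [← he, hr]
    · exact ⟨r, le_two_mul r, h r, map_even r ▸ le_two_mul _, rfl, .inl ⟨rfl, map_even r⟩⟩
    · exact ⟨r, (le_two_mul r).trans le_self_add, h r,
        map_odd r ▸ (le_two_mul _).trans le_self_add, rfl, .inr ⟨rfl, map_odd r⟩⟩
  · rintro ⟨r, -, _, -, rfl, ⟨h₀, h₁⟩ | ⟨h₀, h₁⟩⟩
    exacts [by rw [h₀, h₁, map_even], by rw [h₀, h₁, map_odd]]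

theorem exists_isPaired_map_two_mul {h : M → M} [FunDef h] (hinj : Function.Injective h)
    (hzero : h 0 = 0) : ∃ g : M → M, FunDef g ∧ IsPaired g ∧ ∀ r, g (2 * r) = 2 * h r := by
  have hex (x : M) : ∃ v r, x = 2 * r ∧ v = 2 * h r ∨ x = 2 * r + 1 ∧ v = 2 * h r + 1 := by
    obtain ⟨r, hr | hr⟩ := exists_eq_two_mul_or_eq_two_mul_add_one x
    exacts [⟨_, r, .inl ⟨hr, rfl⟩⟩, ⟨_, r, .inr ⟨hr, rfl⟩⟩]
  choose g hg using hex
  have map_even (r : M) : g (2 * r) = 2 * h r := by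
    obtain ⟨r', ⟨hr, hgr⟩ | ⟨hr, -⟩⟩ := hg (2 * r)
    · rw [hgr, two_mul_inj.1 hr]
    · exact absurd hr.symm (two_mul_add_one_ne_two_mul _ _)
  have map_odd (r : M) : g (2 * r + 1) = 2 * h r + 1 := by
    obtain ⟨r', ⟨hr, -⟩ | ⟨hr, hgr⟩⟩ := hg (2 * r + 1)
    · exact absurd hr (two_mul_add_one_ne_two_mul _ _)
    · rw [hgr, two_mul_inj.1 (add_right_cancel hr)]
  refine ⟨g, .of_map_two_mul map_even map_odd, ⟨fun x y hxy => ?_, ?_, fun r => ?_⟩, map_even⟩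
  · obtain ⟨r, rfl | rfl⟩ := exists_eq_two_mul_or_eq_two_mul_add_one x <;>
      obtain ⟨s, rfl | rfl⟩ := exists_eq_two_mul_or_eq_two_mul_add_one y <;>
      simp only [map_even, map_odd, add_left_inj, two_mul_inj, hinj.eq_iff] at hxy ⊢
    · exact hxy
    · exact absurd hxy.symm (two_mul_add_one_ne_two_mul _ _)
    · exact absurd hxy (two_mul_add_one_ne_two_mul _ _)
    · exact hxy
  · simpa [hzero] using map_even 0
  · rw [map_even, map_odd]

end

/-! ### Enumerating a `Σ⁰₁` set -/

section

variable {M : Type u} [L2Structure M] [hM : Fact (IsModelRCA0 M)] {P : M → M → Prop} {n r : M}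

variable (P) in
/-- The stage `r` codes the pair of `n` and the least witness `y` with `P n y`; the successor keeps
the stage `0` free. -/
def IsFirstWitness (r n : M) : Prop :=
  ∃ y, y ≤ r ∧ (r = pair n y + 1 ∧ (P n y ∧ ∀ y', y' < y → ¬ P n y'))

theorem IsFirstWitness.right_le (h : IsFirstWitness P r n) : n ≤ r := by
  obtain ⟨y, -, rfl, -⟩ := h
  exact (left_le_pair ..).trans le_self_add

theorem IsFirstWitness.right_unique {n' : M} (h : IsFirstWitness P r n)
    (h' : IsFirstWitness P r n') : n = n' := by
  obtain ⟨y, -, rfl, -⟩ := h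
  obtain ⟨y', -, hr, -⟩ := h'
  exact (pair_inj.1 (add_right_cancel hr)).1

theorem IsFirstWitness.left_unique {r' : M} (h : IsFirstWitness P r n)
    (h' : IsFirstWitness P r' n) : r = r' := by
  obtain ⟨y, -, rfl, hy, hlt⟩ := h
  obtain ⟨y', -, rfl, hy', hlt'⟩ := h'
  rw [le_antisymm (le_of_not_gt fun h => hlt _ h hy') (le_of_not_gt fun h => hlt' _ h hy)]

theorem not_isFirstWitness_zero : ¬ IsFirstWitness P 0 n := by
  rintro ⟨y, -, h, -⟩
  exact (add_one_pos _).ne h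

open Classical in
variable (P) in
/-- An injective enumeration of a set that contains `2 * n + 1` if and only if `P n y` for some
`y`. The even numbers are used for the stages that find no such `n`. -/
noncomputable def enumerate (r : M) : M :=
  if h : ∃ n, IsFirstWitness P r n then 2 * h.choose + 1 else 2 * r

theorem IsFirstWitness.enumerate_eq (h : IsFirstWitness P r n) : enumerate P r = 2 * n + 1 := by
  have hex : ∃ n, IsFirstWitness P r n := ⟨n, h⟩
  rw [enumerate, dif_pos hex, hex.choose_spec.right_unique h]

theorem enumerate_eq_of_forall_not (h : ∀ n, ¬ IsFirstWitness P r n) : enumerate P r = 2 * r :=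
  dif_neg (not_exists.2 h)

theorem enumerate_zero : enumerate P 0 = 0 := by
  rw [enumerate_eq_of_forall_not fun _ => not_isFirstWitness_zero, mul_zero]

theorem enumerate_eq_two_mul_add_one_iff : enumerate P r = 2 * n + 1 ↔ IsFirstWitness P r n := by
  refine ⟨fun h => ?_, IsFirstWitness.enumerate_eq⟩
  by_cases hex : ∃ n, IsFirstWitness P r n
  · obtain ⟨n', hn'⟩ := hex
    rw [hn'.enumerate_eq, add_left_inj, two_mul_inj] at h
    exact h ▸ hn'
  · exact absurd (h.symm.trans (enumerate_eq_of_forall_not (not_exists.1 hex)))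
      (two_mul_add_one_ne_two_mul _ _)

theorem enumerate_injective : Function.Injective (enumerate P) := by
  intro r s h
  by_cases hr : ∃ n, IsFirstWitness P r n
  · obtain ⟨n, hn⟩ := hr
    exact hn.left_unique (enumerate_eq_two_mul_add_one_iff.1 (h ▸ hn.enumerate_eq))
  by_cases hs : ∃ n, IsFirstWitness P s n
  · obtain ⟨n, hn⟩ := hs
    exact (enumerate_eq_two_mul_add_one_iff.1 (h.trans hn.enumerate_eq)).left_unique hn
  · rwa [enumerate_eq_of_forall_not (not_exists.1 hr), enumerate_eq_of_forall_not (not_exists.1 hs),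
      two_mul_inj] at h

theorem exists_enumerate_eq_iff [hP : Sigma0 fun e => P (e 0) (e 1)] :
    (∃ r, enumerate P r = 2 * n + 1) ↔ ∃ y, P n y := by
  simp only [enumerate_eq_two_mul_add_one_iff]
  refine ⟨fun ⟨_, y, _, _, hy, _⟩ => ⟨y, hy⟩, fun h => ?_⟩
  have := hP.comp₂
  obtain ⟨y, hy, hlt⟩ := exists_least (P n) h
  exact ⟨_, y, (right_le_pair n y).trans le_self_add, rfl, hy, hlt⟩

instance FunDef.enumerate [hP : Sigma0 fun e => P (e 0) (e 1)] : FunDef (enumerate P) := by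
  have := hP.comp₂
  have sigma0_isFirstWitness := Sigma0.comp₂ (P := IsFirstWitness P) (by
    unfold IsFirstWitness
    infer_instance)
  refine ⟨.congr (P := fun e => (∃ n, n ≤ e 0 ∧ (IsFirstWitness P (e 0) n ∧ e 1 = 2 * n + 1)) ∨
    (∀ n, n ≤ e 0 → ¬ IsFirstWitness P (e 0) n) ∧ e 1 = 2 * e 0) inferInstance fun e => ?_⟩
  constructor
  · intro he
    by_cases hex : ∃ n, IsFirstWitness P (e 0) n
    · obtain ⟨n, hn⟩ := hex
      exact .inl ⟨n, hn.right_le, hn, he.symm.trans hn.enumerate_eq⟩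
    · have hnot := not_exists.1 hex
      exact .inr ⟨fun n _ => hnot n, he.symm.trans (enumerate_eq_of_forall_not hnot)⟩
  · rintro (⟨n, -, hn, he⟩ | ⟨hnot, he⟩)
    · rw [he, hn.enumerate_eq]
    · rw [he, enumerate_eq_of_forall_not fun n hn => hnot n hn.right_le hn]

theorem sigma1Comprehension_of_flatUpperNoetherian (hNoeth : FlatUpperNoetherian M) :
    Sigma1Comprehension M := by
  intro Q hQ
  obtain ⟨P, _, hQP⟩ := hQ.exists_binary
  obtain ⟨g, _, hg, map_two_mul⟩ := exists_isPaired_map_two_mul (enumerate_injective (P := P))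
    enumerate_zero
  have mem_range_iff (n : M) : (∃ x, g x = 2 * (2 * n + 1)) ↔ Q n := by
    rw [hQP, ← exists_enumerate_eq_iff]
    refine ⟨fun ⟨x, hx⟩ => ?_, fun ⟨r, hr⟩ => ⟨2 * r, by rw [map_two_mul, hr]⟩⟩
    obtain ⟨r, rfl | rfl⟩ := exists_eq_two_mul_or_eq_two_mul_add_one x
    · exact ⟨r, two_mul_inj.1 ((map_two_mul r).symm.trans hx)⟩
    · rw [hg.map_two_mul_add_one, map_two_mul] at hx
      exact absurd hx (two_mul_add_one_ne_two_mul _ _)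
  by_contra hc
  refine hg.not_isNoetherian (hNoeth _ (stageValueOrder_isWqo hg.injective fun hrange => hc ?_))
  have : Fact ({n | ∃ x, g x = n} ∈ L2Structure.sets) := ⟨hrange⟩
  have : Sigma0 fun e : ℕ → M => 2 * (2 * e 0 + 1) ∈ {n | ∃ x, g x = n} :=
    Sigma0.mem (t := fun e => 2 * (2 * e 0 + 1))
  convert setOf_mem_sets fun n : M => 2 * (2 * n + 1) ∈ {n | ∃ x, g x = n} using 2
  exact funext fun n => propext (mem_range_iff n).symm

end

end SecondOrderArithmetic

/-- Over `RCA₀`, the statement "if `Q` is a wqo, then the upper topology of `P_f^♭(Q)` is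
Noetherian" implies `ACA₀`: every structure of second-order arithmetic, standard or not, that
satisfies `RCA₀` and the statement satisfies `ACA₀`. -/
theorem theorem4p4 (M : Type*) [SecondOrderArithmetic.L2Structure M]
    (hRCA : SecondOrderArithmetic.IsModelRCA0 M)
    (hNoeth : SecondOrderArithmetic.FlatUpperNoetherian M) :
    SecondOrderArithmetic.IsModelACA0 M := by
  have : Fact (SecondOrderArithmetic.IsModelRCA0 M) := ⟨hRCA⟩
  exact SecondOrderArithmetic.isModelACA0_of_sigma1Comprehension
    (SecondOrderArithmetic.sigma1Comprehension_of_flatUpperNoetherian hNoeth)
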